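/- Let $G$ be a finite group and let $\pi : G \to U(K)$ be a unitary representation of $G$ on an infinite-dimensional complex Hilbert space $K$ (not necessarily separable). Let $\mathcal{L}_\pi$ be the signature of continuous logic with function symbols $0$, $-$, $\dot 2$, $\frac{x+y}{2}$, $e^{i\theta}$ (for $\theta \in 2\pi\mathbb{Q}$) and $\pi(g)$ (for $g \in G$), whose only predicate is the metric. View $(K,\pi)$ as the $\mathcal{L}_\pi$-structure on the closed unit ball of $K$ with metric $d(x,y)=\|x-y\|$, where $\dot 2 x = 2x$ if $\|x\|\le 1/2$ and $\dot 2 x = x/\|x\|$ otherwise, $e^{i\theta}$ is scalar multiplication, and the symbols $\pi(g)$ are interpreted as the unitary maps $\pi(g)$. The moduli of uniform continuity are $\varepsilon\mapsto\varepsilon/2$ for $\dot 2$ and $\varepsilon\mapsto\varepsilon$ for the other symbols. Let $IHS_\pi = \mathrm{Th}(K,\pi)$ be the complete continuous first-order $\mathcal{L}_\pi$-theory of this structure. Then: 1. $IHS_\pi$ has quantifier elimination: for every $n\ge 0$, every $\mathcal{L}_\pi$-formula $\varphi(x_1,\dots,x_n)$ and every $\varepsilon>0$ there is a quantifier-free $\mathcal{L}_\pi$-formula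 $\psi(x_1,\dots,x_n)$ such that $|\varphi^M(a)-\psi^M(a)|\le\varepsilon$ for all models $M$ of $IHS_\pi$ and all $a\in M^n$. 2. If $M$ is a separable model of $IHS_\pi$ and $a,b\in M^n$ are tuples with the same quantifier-free type, then there is an automorphism $\sigma$ of the $\mathcal{L}_\pi$-structure $M$ with $\sigma(a_i)=b_i$ for all $1\le i\le n$. -/

import Mathlib

universe u v w

/-!
# Continuous first-order logic, and Hilbert spaces with a unitary representation

The first part is real-valued continuous first-order logic for bounded metric structures: every
continuous function `ℝᵏ → ℝ` is a connective, and the quantifiers are `sup` and `inf`.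
The second part is the language of Hilbert spaces with a unitary representation of a group `G`, the
closed unit ball of such a space as a structure for it, and its complete theory.
-/

namespace ContLogic

/-- A continuous signature: function and predicate symbols with their arities, a modulus of uniform
continuity for each symbol, a bounded interval of values for each predicate symbol and a bound on
the diameter. The metric is an implicit binary predicate. -/
structure Signature where
  Func : ℕ → Type u
  Pred : ℕ → Type u
  funcModulus : ∀ {k : ℕ}, Func k → ℝ → ℝ
  predModulus : ∀ {k : ℕ}, Pred k → ℝ → ℝ
  funcModulus_pos : ∀ {k : ℕ} (f : Func k) (ε : ℝ), 0 < ε → 0 < funcModulus f ε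
  predModulus_pos : ∀ {k : ℕ} (P : Pred k) (ε : ℝ), 0 < ε → 0 < predModulus P ε
  lower : ∀ {k : ℕ}, Pred k → ℝ
  upper : ∀ {k : ℕ}, Pred k → ℝ
  diamBound : ℝ

/-- A metric structure: a nonempty complete bounded metric space, with interpretations of the
symbols that obey the moduli of uniform continuity. The distance on `Fin k → Carrier` is the
maximum of the distances of the coordinates. -/
structure Structure (L : Signature.{v}) where
  Carrier : Type w
  metricSpace : MetricSpace Carrier
  nonempty : Nonempty Carrier
  complete : CompleteSpace Carrier
  dist_le : ∀ x y : Carrier, dist x y ≤ L.diamBound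
  func : ∀ {k : ℕ}, L.Func k → (Fin k → Carrier) → Carrier
  pred : ∀ {k : ℕ}, L.Pred k → (Fin k → Carrier) → ℝ
  func_modulus : ∀ {k : ℕ} (f : L.Func k) (ε : ℝ), 0 < ε → ∀ x y : Fin k → Carrier,
    dist x y < L.funcModulus f ε → dist (func f x) (func f y) ≤ ε
  pred_modulus : ∀ {k : ℕ} (P : L.Pred k) (ε : ℝ), 0 < ε → ∀ x y : Fin k → Carrier,
    dist x y < L.predModulus P ε → |pred P x - pred P y| ≤ ε
  pred_mem : ∀ {k : ℕ} (P : L.Pred k) (x : Fin k → Carrier),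
    pred P x ∈ Set.Icc (L.lower P) (L.upper P)

instance (L : Signature.{v}) (M : Structure.{v, w} L) : MetricSpace M.Carrier := M.metricSpace

instance (L : Signature.{v}) (M : Structure.{v, w} L) : Nonempty M.Carrier := M.nonempty

instance (L : Signature.{v}) (M : Structure.{v, w} L) : CompleteSpace M.Carrier := M.complete

/-- Terms in the variables `x₀, …, xₙ₋₁`. -/
inductive Term (L : Signature.{v}) (n : ℕ) : Type v
  | var (i : Fin n) : Term L n
  | app {k : ℕ} (f : L.Func k) (ts : Fin k → Term L n) : Term L n

/-- The value of a term at a tuple. -/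
def Term.eval {L : Signature.{v}} (M : Structure.{v, w} L) {n : ℕ} (a : Fin n → M.Carrier) :
    Term L n → M.Carrier
  | .var i => a i
  | .app f ts => M.func f (fun i => (ts i).eval M a)

/-- Formulas whose free variables are among `x₀, …, xₙ₋₁`; the quantifiers bind the last variable
`xₙ` of a formula in `x₀, …, xₙ`. -/
inductive Formula (L : Signature.{v}) : ℕ → Type v
  | dist {n : ℕ} (s t : Term L n) : Formula L n
  | pred {n k : ℕ} (P : L.Pred k) (ts : Fin k → Term L n) : Formula L n
  | conn {n k : ℕ} (c : C(Fin k → ℝ, ℝ)) (φ : Fin k → Formula L n) : Formula L n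
  | sup {n : ℕ} (φ : Formula L (n + 1)) : Formula L n
  | inf {n : ℕ} (φ : Formula L (n + 1)) : Formula L n

/-- The value `φᴹ(a)` of a formula at a tuple. -/
noncomputable def Formula.eval {L : Signature.{v}} (M : Structure.{v, w} L) :
    {n : ℕ} → Formula L n → (Fin n → M.Carrier) → ℝ
  | _, .dist s t, a => Dist.dist (s.eval M a) (t.eval M a)
  | _, .pred P ts, a => M.pred P (fun i => (ts i).eval M a)
  | _, .conn c φ, a => c (fun i => (φ i).eval M a)
  | _, .sup φ, a => ⨆ x : M.Carrier, φ.eval M (Fin.snoc a x)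
  | _, .inf φ, a => ⨅ x : M.Carrier, φ.eval M (Fin.snoc a x)

/-- Every formula is bounded in every structure, so the suprema and infima in `Formula.eval` are
taken over nonempty bounded sets of reals. -/
theorem Formula.exists_abs_eval_le {L : Signature.{v}} (M : Structure.{v, w} L) {n : ℕ}
    (φ : Formula L n) : ∃ C : ℝ, ∀ a : Fin n → M.Carrier, |φ.eval M a| ≤ C := by
  induction φ with
  | dist s t =>
    refine ⟨L.diamBound, fun a => ?_⟩
    rw [Formula.eval, abs_of_nonneg dist_nonneg]
    exact M.dist_le _ _
  | pred P ts =>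
    refine ⟨max |L.lower P| |L.upper P|, fun a => ?_⟩
    rw [Formula.eval]
    exact abs_le_max_abs_abs (M.pred_mem P _).1 (M.pred_mem P _).2
  | conn c φ ih =>
    choose C hC using ih
    have hK : IsCompact (Set.univ.pi fun i => Set.Icc (-C i) (C i)) :=
      isCompact_univ_pi fun i => isCompact_Icc
    obtain ⟨B, hB⟩ := hK.exists_bound_of_continuousOn c.continuous.continuousOn
    refine ⟨B, fun a => ?_⟩
    rw [Formula.eval]
    exact hB _ fun i _ => abs_le.1 (hC i a)
  | sup φ ih =>
    obtain ⟨C, hC⟩ := ih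
    refine ⟨C, fun a => ?_⟩
    rw [Formula.eval]
    obtain ⟨x₀⟩ := M.nonempty
    refine abs_le.2 ⟨?_, ciSup_le fun x => (abs_le.1 (hC _)).2⟩
    exact (abs_le.1 (hC (Fin.snoc a x₀))).1.trans
      (le_ciSup (f := fun x => φ.eval M (Fin.snoc a x))
        ⟨C, by rintro _ ⟨x, rfl⟩; exact (abs_le.1 (hC _)).2⟩ x₀)
  | inf φ ih =>
    obtain ⟨C, hC⟩ := ih
    refine ⟨C, fun a => ?_⟩
    rw [Formula.eval]
    obtain ⟨x₀⟩ := M.nonempty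
    refine abs_le.2 ⟨le_ciInf fun x => (abs_le.1 (hC _)).1, ?_⟩
    exact (ciInf_le (f := fun x => φ.eval M (Fin.snoc a x))
        ⟨-C, by rintro _ ⟨x, rfl⟩; exact (abs_le.1 (hC _)).1⟩ x₀).trans
      (abs_le.1 (hC (Fin.snoc a x₀))).2

/-- Quantifier-free formulas. -/
def Formula.IsQF {L : Signature.{v}} : {n : ℕ} → Formula L n → Prop
  | _, .dist _ _ => True
  | _, .pred _ _ => True
  | _, .conn _ φ => ∀ i, (φ i).IsQF
  | _, .sup _ => False
  | _, .inf _ => False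

/-- A theory is a set of sentences `φ`, each standing for the condition `φ = 0`. -/
abbrev Theory (L : Signature.{v}) : Type v := Set (Formula L 0)

/-- `M` is a model of `T`. -/
def Theory.Model {L : Signature.{v}} (T : Theory L) (M : Structure.{v, w} L) : Prop :=
  ∀ φ ∈ T, φ.eval M Fin.elim0 = 0

/-- The complete theory `Th(M)`. -/
def Structure.theory {L : Signature.{v}} (M : Structure.{v, w} L) : Theory L :=
  {φ | φ.eval M Fin.elim0 = 0}

/-- Quantifier elimination: every formula is approximated, up to every `ε > 0` and uniformly over
all tuples in all models of `T`, by a quantifier-free formula in the same variables. -/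
def Theory.HasQuantifierElimination {L : Signature.{v}} (T : Theory L) : Prop :=
  ∀ (n : ℕ) (φ : Formula L n) (ε : ℝ), 0 < ε → ∃ ψ : Formula L n, ψ.IsQF ∧
    ∀ M : Structure.{v, w} L, T.Model M → ∀ a : Fin n → M.Carrier,
      |φ.eval M a - ψ.eval M a| ≤ ε

/-- The quantifier-free type of a tuple: the quantifier-free conditions `φ = 0` it satisfies. -/
def Structure.qfType {L : Signature.{v}} (M : Structure.{v, w} L) {n : ℕ}
    (a : Fin n → M.Carrier) : Set (Formula L n) :=
  {φ | φ.IsQF ∧ φ.eval M a = 0}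

/-- Automorphisms: isometric bijections that preserve all symbols. -/
structure Automorphism {L : Signature.{v}} (M : Structure.{v, w} L) where
  toIsometryEquiv : M.Carrier ≃ᵢ M.Carrier
  map_func : ∀ {k : ℕ} (f : L.Func k) (x : Fin k → M.Carrier),
    toIsometryEquiv (M.func f x) = M.func f (fun i => toIsometryEquiv (x i))
  map_pred : ∀ {k : ℕ} (P : L.Pred k) (x : Fin k → M.Carrier),
    M.pred P (fun i => toIsometryEquiv (x i)) = M.pred P x

end ContLogic

namespace UnitaryRep

open ContLogic

/-- The function symbols `0`, `-`, `2̇`, `(x + y) / 2`, `e^{iθ}` for `θ = 2πq` with `q ∈ ℚ`, and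
`π(g)` for `g ∈ G`. -/
inductive RepFunc (G : Type v) : ℕ → Type v
  | zero : RepFunc G 0
  | neg : RepFunc G 1
  | double : RepFunc G 1
  | mid : RepFunc G 2
  | rot (q : ℚ) : RepFunc G 1
  | act (g : G) : RepFunc G 1

/-- The modulus of continuity is `ε / 2` for `2̇`, and `ε` for the other symbols. -/
noncomputable def RepFunc.modulus {G : Type v} : {k : ℕ} → RepFunc G k → ℝ → ℝ
  | _, .double, ε => ε / 2
  | _, _, ε => ε

/-- The language of Hilbert spaces with a unitary representation of `G`; the only predicate is the
metric. -/
noncomputable def repSignature (G : Type v) : Signature.{v} where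
  Func := RepFunc G
  Pred := fun _ => PEmpty
  funcModulus := RepFunc.modulus
  predModulus := fun P => P.elim
  funcModulus_pos := by
    intro k f ε hε
    cases f <;> simp only [RepFunc.modulus] <;> linarith
  predModulus_pos := fun P => P.elim
  lower := fun P => P.elim
  upper := fun P => P.elim
  diamBound := 2

section Ball

variable {K : Type u} [NormedAddCommGroup K] [InnerProductSpace ℂ K]

/-- The truncation `y ↦ y / max 1 ‖y‖` of a vector to the closed unit ball. -/
noncomputable def trunc (y : K) : K := (max 1 ‖y‖)⁻¹ • y

theorem norm_trunc_le (y : K) : ‖trunc y‖ ≤ 1 := by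
  have h : 0 < max 1 ‖y‖ := lt_max_of_lt_left one_pos
  rw [trunc, norm_smul, norm_inv, Real.norm_of_nonneg h.le, inv_mul_le_iff₀ h, mul_one]
  exact le_max_right _ _

theorem re_inner_trunc_le (y z : K) (hz : ‖z‖ ≤ 1) :
    RCLike.re (inner ℂ (y - trunc y) (z - trunc y)) ≤ 0 := by
  rcases le_total ‖y‖ 1 with h | h
  · simp [trunc, max_eq_left h]
  · have hy : 0 < ‖y‖ := one_pos.trans_le h
    have e : y - trunc y = ((1 - ‖y‖⁻¹ : ℝ) : ℂ) • y := by
      rw [trunc, max_eq_right h, Complex.coe_smul, sub_smul, one_smul]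
    have e2 : RCLike.re (inner ℂ y (trunc y)) = ‖y‖ := by
      have : trunc y = ((‖y‖⁻¹ : ℝ) : ℂ) • y := by rw [trunc, max_eq_right h, Complex.coe_smul]
      rw [this, inner_smul_right]
      have := inner_self_eq_norm_sq_to_K (𝕜 := ℂ) y
      rw [this]
      simp only [RCLike.re_to_complex, Complex.coe_algebraMap, Complex.re_ofReal_mul]
      rw [← Complex.ofReal_pow, Complex.ofReal_re]
      field_simp
    have e3 : RCLike.re (inner ℂ y z) ≤ ‖y‖ :=
      (re_inner_le_norm y z).trans (by nlinarith [norm_nonneg y])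
    rw [e, inner_smul_left, inner_sub_right]
    have h1 : 0 ≤ 1 - ‖y‖⁻¹ := sub_nonneg.2 (inv_le_one_of_one_le₀ h)
    rw [Complex.conj_ofReal]
    simp only [RCLike.re_to_complex, Complex.re_ofReal_mul, Complex.sub_re] at *
    exact mul_nonpos_of_nonneg_of_nonpos h1 (by linarith)

theorem norm_trunc_sub_le (y z : K) : ‖trunc y - trunc z‖ ≤ ‖y - z‖ := by
  have h1 := re_inner_trunc_le y (trunc z) (norm_trunc_le z)
  have h2 := re_inner_trunc_le z (trunc y) (norm_trunc_le y)
  have h3 := re_inner_le_norm (𝕜 := ℂ) (y - z) (trunc y - trunc z)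
  have h4 : RCLike.re (inner ℂ (trunc y - trunc z) (trunc y - trunc z))
      = ‖trunc y - trunc z‖ ^ 2 := inner_self_eq_norm_sq (𝕜 := ℂ) _
  simp only [inner_sub_left, inner_sub_right, map_sub] at h1 h2 h3 h4
  by_contra! hlt
  nlinarith [norm_nonneg (y - z)]

end Ball

variable {G : Type v} [Group G] {K : Type u} [NormedAddCommGroup K] [InnerProductSpace ℂ K]
  [CompleteSpace K]

/-- The interpretation of the symbols on vectors. Here `2̇ x` is `2 x` when `‖x‖ ≤ 1 / 2`, and
`x / ‖x‖` otherwise. -/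
noncomputable def interp (π : G →* unitary (K →L[ℂ] K)) :
    {k : ℕ} → RepFunc G k → (Fin k → K) → K
  | _, .zero, _ => 0
  | _, .neg, x => -x 0
  | _, .double, x => trunc ((2 : ℝ) • x 0)
  | _, .mid, x => (2⁻¹ : ℝ) • (x 0 + x 1)
  | _, .rot q, x => Complex.exp (2 * Real.pi * q * Complex.I) • x 0
  | _, .act g, x => (π g : K →L[ℂ] K) (x 0)

theorem norm_rot (q : ℚ) : ‖Complex.exp (2 * Real.pi * q * Complex.I)‖ = 1 := by
  have := Complex.norm_exp_ofReal_mul_I (2 * Real.pi * q)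
  push_cast at this
  exact this

theorem norm_interp_le (π : G →* unitary (K →L[ℂ] K)) {k : ℕ} (f : RepFunc G k) (x : Fin k → K)
    (hx : ∀ i, ‖x i‖ ≤ 1) : ‖interp π f x‖ ≤ 1 := by
  cases f with
  | zero => simp [interp]
  | neg => simpa [interp] using hx 0
  | double => exact norm_trunc_le _
  | mid =>
    rw [interp, norm_smul, Real.norm_of_nonneg (by norm_num)]
    linarith [norm_add_le (x 0) (x 1), hx 0, hx 1]
  | rot q => simpa [interp, norm_smul, norm_rot] using hx 0
  | act g =>
    rw [interp, ContinuousLinearMap.norm_map_of_mem_unitary (π g).2]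
    exact hx 0

theorem norm_interp_sub_le (π : G →* unitary (K →L[ℂ] K)) {k : ℕ} (f : RepFunc G k)
    (x y : Fin k → K) (ε : ℝ) (hε : 0 < ε) (h : ∀ i, ‖x i - y i‖ < f.modulus ε) :
    ‖interp π f x - interp π f y‖ ≤ ε := by
  cases f with
  | zero => simpa [interp] using hε.le
  | neg =>
    have h0 : ‖x 0 - y 0‖ < ε := h 0
    rw [interp, interp, neg_sub_neg, norm_sub_rev]
    exact h0.le
  | double =>
    have h0 : ‖x 0 - y 0‖ < ε / 2 := h 0
    refine (norm_trunc_sub_le _ _).trans ?_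
    rw [← smul_sub, norm_smul, Real.norm_of_nonneg (by norm_num)]
    linarith
  | mid =>
    have h0 : ‖x 0 - y 0‖ < ε := h 0
    have h1 : ‖x 1 - y 1‖ < ε := h 1
    rw [interp, interp, ← smul_sub, norm_smul, Real.norm_of_nonneg (by norm_num),
      add_sub_add_comm]
    linarith [norm_add_le (x 0 - y 0) (x 1 - y 1)]
  | rot q =>
    have h0 : ‖x 0 - y 0‖ < ε := h 0
    rw [interp, interp, ← smul_sub, norm_smul, norm_rot, one_mul]
    exact h0.le
  | act g =>
    have h0 : ‖x 0 - y 0‖ < ε := h 0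
    rw [interp, interp, ← map_sub, ContinuousLinearMap.norm_map_of_mem_unitary (π g).2]
    exact h0.le

/-- The structure `(K, π)`: the closed unit ball of `K` with the distance `‖x - y‖`. -/
noncomputable def ballStructure (π : G →* unitary (K →L[ℂ] K)) :
    Structure.{v, u} (repSignature G) where
  Carrier := Metric.closedBall (0 : K) 1
  metricSpace := inferInstance
  nonempty := ⟨⟨0, by simp⟩⟩
  complete := Metric.isClosed_closedBall.isComplete.completeSpace_coe
  dist_le := fun x y => by
    have hx := mem_closedBall_zero_iff.1 x.2
    have hy := mem_closedBall_zero_iff.1 y.2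
    rw [Subtype.dist_eq, dist_eq_norm]
    exact (norm_sub_le _ _).trans (by simpa [repSignature] using by linarith)
  func := fun f x => ⟨interp π f fun i => (x i : K), mem_closedBall_zero_iff.2
    (norm_interp_le π f _ fun i => mem_closedBall_zero_iff.1 (x i).2)⟩
  pred := fun P => P.elim
  func_modulus := fun f ε hε x y h => by
    rw [Subtype.dist_eq, dist_eq_norm]
    refine norm_interp_sub_le π f _ _ ε hε fun i => ?_
    rw [← dist_eq_norm]
    exact (dist_le_pi_dist x y i).trans_lt h
  pred_modulus := fun P => P.elim
  pred_mem := fun P => P.elim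

/-- The theory `IHS_π = Th(K, π)`. -/
noncomputable def IHS (π : G →* unitary (K →L[ℂ] K)) : Theory (repSignature G) :=
  (ballStructure π).theory

end UnitaryRep

/-!
Both parts rest on one fact about a unitary representation `π` of a finite group: the inner products
`⟪aᵢ, π(g) aⱼ⟫` determine a tuple `a` up to unitary operators that commute with `π`, and they do so
continuously.

* If the inner products of `a` and `b` agree, such a unitary carries `a` to `b`
  (`exists_intertwiner_map_eq`). The linear span of the orbit of `a` has finite dimension because
  `G` is finite, and `π(g) aᵢ ↦ π(g) bᵢ` defines a partial isometry `u` of finite rank in the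
  commutant of `π`. In a finite-dimensional C⋆-algebra a partial isometry always extends to a
  unitary. Here the perturbations `u + ε` are invertible for suitable small `ε > 0`, because `u`
  has finitely many eigenvalues, so the unitary factor `σ` of the polar decomposition of `u + ε`
  nearly extends `u`; then `u + (1 - q) σ (1 - p)`, with `p` and `q` the initial and final
  projections of `u`, is invertible, and its unitary factor extends `u` exactly.
* If the inner products are only close, such a unitary carries `a` close to `b`
  (`exists_intertwiner_norm_sub_le`). Let `v` and `w` be the orbits of `a` and `b`, and
  `T = ∑ₖ |wₖ⟩⟨vₖ|`. Then `T* T` and `T T*` are close to the squares of `S = ∑ₖ |vₖ⟩⟨vₖ|` and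
  `S' = ∑ₖ |wₖ⟩⟨wₖ|`, so by the Hölder continuity of the square root `|T|` and `|T*|` are close to
  `S` and `S'`. The unitary factor `σ` of `T + ε` therefore makes `∑ₖ |σ vₖ - wₖ⟩⟨σ vₖ - wₖ|` small.

Quantifier elimination is a universal condition, so it only has to be checked in `(K, π)`
(`Structure.theory_hasQuantifierElimination`). There, the value of a formula is a uniformly
continuous function of the tuple and is invariant under automorphisms, hence by the second fact it
is nearly a continuous function of the inner products `⟪aᵢ, π(g) aⱼ⟫`. By polarization these are
quantifier-free definable.

For homogeneity, a model `M` of `IHS π` is shown to be the unit ball of a Hilbert space with a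
unitary representation (`exists_ballRealization`): the polarized inner product of `M` is a positive
semidefinite kernel and thus comes from vectors in a Hilbert space, the symbols have their standard
interpretation there because linear relations between terms are universal conditions, and the image
is the whole ball because it is closed under the interpretations of the symbols. Tuples with
the same quantifier-free type have the same inner products, and the first fact applies.
-/

open scoped InnerProductSpace ComplexConjugate

/-! ### Square roots and polar decompositions in C⋆-algebras -/

namespace CStarAlgebra

variable {A : Type*} [CStarAlgebra A]

theorem norm_le_one_of_mem_unitary {σ : A} (hσ : σ ∈ unitary A) : ‖σ‖ ≤ 1 := by
  nontriviality A
  exact (CStarRing.norm_of_mem_unitary hσ).le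

variable [PartialOrder A] [StarOrderedRing A]

theorem le_of_mul_self_le_mul_self {x y : A} (hx : 0 ≤ x) (hy : 0 ≤ y)
    (h : x * x ≤ y * y) : x ≤ y := by
  have := CFC.sqrt_le_sqrt _ _ h
  rwa [CFC.sqrt_mul_self x, CFC.sqrt_mul_self y] at this

/-- The square root is `1/2`-Hölder continuous on positive elements: with `δ = ‖x² - y²‖`,
operator monotonicity of the square root turns `x² ≤ y² + δ ≤ (y + √δ)²` into `x ≤ y + √δ`. -/
theorem norm_sub_sq_le_norm_mul_self_sub {x y : A} (hx : 0 ≤ x) (hy : 0 ≤ y) :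
    ‖x - y‖ ^ 2 ≤ ‖x * x - y * y‖ := by
  have key : ∀ {x y : A}, 0 ≤ x → 0 ≤ y → x - y ≤ algebraMap ℝ A √‖x * x - y * y‖ := by
    intro x y hx hy
    set δ := ‖x * x - y * y‖
    have hs : (0 : A) ≤ algebraMap ℝ A √δ := algebraMap_nonneg A (Real.sqrt_nonneg δ)
    rw [sub_le_iff_le_add']
    refine le_of_mul_self_le_mul_self hx (add_nonneg hy hs) ?_
    have hxs : IsSelfAdjoint (x * x - y * y) := by
      rw [← pow_two, ← pow_two]
      exact ((IsSelfAdjoint.of_nonneg hx).pow 2).sub ((IsSelfAdjoint.of_nonneg hy).pow 2)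
    have h1 : x * x - y * y ≤ algebraMap ℝ A δ := hxs.le_algebraMap_norm_self
    have h2 : algebraMap ℝ A √δ * algebraMap ℝ A √δ = algebraMap ℝ A δ := by
      rw [← map_mul, Real.mul_self_sqrt (norm_nonneg _)]
    have h3 : (0 : A) ≤ √δ • y := smul_nonneg (Real.sqrt_nonneg _) hy
    have h4 : (y + algebraMap ℝ A √δ) * (y + algebraMap ℝ A √δ)
        = y * y + (√δ • y + √δ • y) + algebraMap ℝ A δ := by
      rw [← h2, mul_add, add_mul, add_mul, ← Algebra.commutes, ← Algebra.smul_def]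
      abel
    rw [h4]
    have : x * x ≤ y * y + algebraMap ℝ A δ := sub_le_iff_le_add'.1 h1
    refine this.trans ?_
    gcongr
    exact le_add_of_nonneg_right (add_nonneg h3 h3)
  have hxy : IsSelfAdjoint (x - y) := (IsSelfAdjoint.of_nonneg hx).sub (.of_nonneg hy)
  have h1 := key hx hy
  have h2 := key hy hx
  rw [norm_sub_rev] at h2
  have h3 : ‖x - y‖ ≤ √‖x * x - y * y‖ := by
    nontriviality A
    have h2' : algebraMap ℝ A (-√‖x * x - y * y‖) ≤ x - y := by
      rw [map_neg, neg_le, neg_sub]; exact h2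
    have e1 := (le_algebraMap_iff_spectrum_le (a := x - y) hxy).1 h1
    have e2 := (algebraMap_le_iff_le_spectrum (a := x - y) hxy).1 h2'
    rcases norm_or_neg_norm_mem_spectrum hxy with h | h
    · exact e1 _ h
    · linarith [e2 _ h]
  calc ‖x - y‖ ^ 2 ≤ √‖x * x - y * y‖ ^ 2 := by gcongr
    _ = _ := Real.sq_sqrt (norm_nonneg _)

/-- The unitary factor of the polar decomposition of an invertible element. It commutes with
everything that commutes with the element and its adjoint. -/
theorem exists_unitary_mul_abs {x : A} (hx : IsUnit x) :
    ∃ σ ∈ unitary A, x = σ * CFC.abs x ∧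
      ∀ c, Commute c x → Commute c (star x) → Commute c σ := by
  have hu : IsUnit (CFC.abs x) := by
    have h : IsUnit (CFC.abs x * CFC.abs x) := by
      rw [CFC.abs_mul_abs]; exact hx.star.mul hx
    exact ((Commute.refl (CFC.abs x)).isUnit_mul_iff.1 h).1
  obtain ⟨y, hy⟩ := hu
  have hys : star (↑y⁻¹ : A) = ↑y⁻¹ := by
    have : star (y : A) = y := by rw [hy]; exact IsSelfAdjoint.of_nonneg (CFC.abs_nonneg x)
    have h2 : star y = y := Units.ext this
    rw [← Units.coe_star, star_inv, h2]
  have h1 : star (x * ↑y⁻¹) * (x * ↑y⁻¹) = 1 := by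
    rw [star_mul, hys]
    calc (↑y⁻¹ : A) * star x * (x * ↑y⁻¹) = ↑y⁻¹ * (star x * x) * ↑y⁻¹ := by
          simp only [mul_assoc]
      _ = 1 := by rw [← CFC.abs_mul_abs, ← hy]; simp
  have hσ : IsUnit (x * ↑y⁻¹) := hx.mul (Units.isUnit _)
  refine ⟨x * ↑y⁻¹, ?_, ?_, ?_⟩
  · rw [Unitary.mem_iff]
    refine ⟨h1, ?_⟩
    obtain ⟨s, hs⟩ := hσ
    rw [← hs] at h1 ⊢
    rw [left_inv_eq_right_inv h1 s.mul_inv, Units.mul_inv]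
  · rw [← hy]; simp
  · intro c h2 h3
    have : Commute c (CFC.abs x) := by
      refine h2.symm.cfcAbs_right ?_
      have := h3.star_star
      rw [star_star] at this
      exact this.symm
    rw [← hy] at this
    exact h2.mul_right (this.units_inv_right)

/-- A partial isometry `u` that is close to a unitary on its initial space extends to a unitary:
with `p` and `q` the initial and final projections, `u + (1 - q) σ (1 - p)` is invertible, and the
unitary factor of its polar decomposition agrees with `u` on the range of `p`. -/
theorem exists_unitary_extending_of_norm_lt {u σ : A} (hu : u * star u * u = u)
    (hσ : σ ∈ unitary A) (h : ‖σ * (star u * u) - u‖ < 1 / 3) :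
    ∃ τ ∈ unitary A, τ * (star u * u) = u ∧ ∀ c, Commute c u → Commute c (star u) →
      Commute c σ → Commute c (star σ) → Commute c τ := by
  set p := star u * u with hp
  set q := u * star u with hq
  have hup : u * p = u := by rw [hp, ← mul_assoc]; exact hu
  have hqu : q * u = u := hu
  have hpp : p * p = p := by rw [hp, mul_assoc, ← mul_assoc u, hu]
  have hqq : q * q = q := by rw [hq, ← mul_assoc, hu]
  have hps : star p = p := by simp [hp]
  have hqs : star q = q := by simp [hq]
  have norm_le : ∀ {e : A}, star e * e = e → ‖e‖ ≤ 1 := by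
    intro e he
    have := CStarRing.norm_star_mul_self (x := e)
    rw [he] at this
    nlinarith [norm_nonneg e]
  have hpn : ‖p‖ ≤ 1 := norm_le (by rw [hps, hpp])
  have hqn : ‖q‖ ≤ 1 := norm_le (by rw [hqs, hqq])
  have hun : ‖u‖ ≤ 1 := by
    have := CStarRing.norm_star_mul_self (x := u)
    rw [← hp] at this
    nlinarith [norm_nonneg u]
  have hσ1 : star σ * σ = 1 := Unitary.star_mul_self_of_mem hσ
  have hσn : ‖σ‖ ≤ 1 := norm_le_one_of_mem_unitary hσ
  set x := u + (1 - q) * σ * (1 - p) with hx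
  have hxp : x * p = u := by
    rw [hx, add_mul, hup, mul_assoc, sub_mul 1 p p, hpp, one_mul, sub_self, mul_zero, add_zero]
  have hxu : star x * u = p := by
    simp only [hx, star_add, star_mul, star_sub, star_one, hps, hqs, add_mul, mul_assoc,
      sub_mul, one_mul, hqu, sub_self, add_zero]
    rfl
  have hunit : IsUnit x := by
    have e : x - σ = (u - σ * p) + q * (σ * p - u) + u * star (σ * p - u) * σ := by
      have e1 : u * star (σ * p - u) * σ = u - q * σ := by
        rw [star_sub, star_mul, hps, mul_sub, sub_mul, ← mul_assoc, hup, mul_assoc, hσ1, mul_one]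
      rw [e1, hx, mul_sub q, hqu]
      noncomm_ring
    have hlt : ‖x - σ‖ < 1 := by
      set η := ‖σ * p - u‖
      have h1 : ‖u - σ * p‖ = η := norm_sub_rev _ _
      have h2 : ‖q * (σ * p - u)‖ ≤ η :=
        (norm_mul_le _ _).trans (mul_le_of_le_one_left (norm_nonneg _) hqn)
      have h3 : ‖u * star (σ * p - u) * σ‖ ≤ η := by
        calc _ ≤ ‖u‖ * ‖star (σ * p - u)‖ * ‖σ‖ := norm_mul₃_le
          _ ≤ 1 * η * 1 := by rw [norm_star]; gcongr
          _ = η := by ring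
      rw [e]
      calc _ ≤ ‖u - σ * p‖ + ‖q * (σ * p - u)‖ + ‖u * star (σ * p - u) * σ‖ :=
            norm_add₃_le
        _ < 1 := by linarith
    have h4 : IsUnit (star σ * x) := by
      have : star σ * x = 1 - star σ * (σ - x) := by rw [mul_sub, hσ1]; abel
      rw [this]
      refine isUnit_one_sub_of_norm_lt_one ?_
      calc _ ≤ ‖star σ‖ * ‖σ - x‖ := norm_mul_le _ _
        _ ≤ 1 * ‖σ - x‖ := by rw [norm_star]; gcongr
        _ < 1 := by rw [one_mul, norm_sub_rev]; exact hlt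
    have h5 : x = σ * (star σ * x) := by
      rw [← mul_assoc, Unitary.mul_star_self_of_mem hσ, one_mul]
    rw [h5]
    exact (IsUnit.mul ⟨⟨σ, star σ, Unitary.mul_star_self_of_mem hσ, hσ1⟩, rfl⟩ h4)
  obtain ⟨τ, hτ, hτx, hcomm⟩ := exists_unitary_mul_abs hunit
  refine ⟨τ, hτ, ?_, ?_⟩
  · -- `|x|² p = p`, so `d = |x| p - p` satisfies `|x| d = -d`, which forces `d = 0`.
    set y := CFC.abs x
    have hy2 : y * (y * p) = p := by
      rw [← mul_assoc, CFC.abs_mul_abs, mul_assoc, hxp, hxu]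
    set d := y * p - p with hd
    have hyd : y * d = -d := by rw [hd, mul_sub, hy2]; abel
    have h1 : 0 ≤ star d * y * d := star_left_conjugate_nonneg (CFC.abs_nonneg x) d
    rw [mul_assoc, hyd, mul_neg] at h1
    have h2 : star d * d = 0 := le_antisymm (neg_nonneg.1 h1) (star_mul_self_nonneg d)
    have h3 : d = 0 := CStarRing.star_mul_self_eq_zero_iff d |>.1 h2
    have h4 : y * p = p := sub_eq_zero.1 h3
    calc τ * p = τ * (y * p) := by rw [h4]
      _ = u := by rw [← mul_assoc, ← hτx, hxp]
  · intro c h1 h2 h3 h4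
    have hcp : Commute c (1 - p) := (Commute.one_right c).sub_right (h2.mul_right h1)
    have hcq : Commute c (1 - q) := (Commute.one_right c).sub_right (h1.mul_right h2)
    refine hcomm c (h1.add_right ((hcq.mul_right h3).mul_right hcp)) ?_
    have : star x = star u + (1 - p) * (star σ * (1 - q)) := by
      simp [hx, hps, hqs]
    rw [this]
    exact h2.add_right (hcp.mul_right (h4.mul_right hcq))

/-- A partial isometry with small invertible scalar perturbations extends to a unitary. -/
theorem exists_unitary_extending {u : A} (hu : u * star u * u = u)
    (h : ∀ δ : ℝ, 0 < δ → ∃ ε : ℝ, 0 < ε ∧ ε < δ ∧ IsUnit (u + algebraMap ℂ A ε)) :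
    ∃ τ ∈ unitary A, τ * (star u * u) = u ∧ ∀ c, Commute c u → Commute c (star u) →
      Commute c τ := by
  obtain ⟨ε, hε, hε1, hunit⟩ := h (1 / 100) (by norm_num)
  set e := algebraMap ℂ A ε with he
  have hes : star e = e := by
    rw [he, Algebra.algebraMap_eq_smul_one, star_smul, star_one, RCLike.star_def,
      Complex.conj_ofReal]
  obtain ⟨σ, hσ, hσx, hcomm⟩ := exists_unitary_mul_abs hunit
  have hce : ∀ c : A, Commute c e := fun c => (Algebra.commutes (ε : ℂ) c).symm
  have hcσ : ∀ c, Commute c u → Commute c (star u) → Commute c σ := fun c h1 h2 =>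
    hcomm c (h1.add_right (hce c)) (by rw [star_add, hes]; exact h2.add_right (hce c))
  have hpp : star u * u * (star u * u) = star u * u := by
    rw [mul_assoc, ← mul_assoc u, hu]
  have hun : ‖u‖ ≤ 1 := by
    have h1 := CStarRing.norm_star_mul_self (x := u)
    have h2 := CStarRing.norm_star_mul_self (x := star u * u)
    rw [star_mul, star_star, hpp] at h2
    have h3 : ‖star u * u‖ ≤ 1 := by nlinarith [norm_nonneg (star u * u)]
    nlinarith [norm_nonneg u]
  have hen : ‖e‖ ≤ ε := by
    rw [he]
    rcases subsingleton_or_nontrivial A with _ | _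
    · rw [Subsingleton.elim (algebraMap ℂ A ε) 0, norm_zero]
      exact hε.le
    refine (norm_algebraMap A (ε : ℂ)).le.trans ?_
    rw [norm_one, mul_one, Complex.norm_real, Real.norm_of_nonneg hε.le]
  set p := star u * u
  set y := CFC.abs (u + e)
  have h1 : ‖y - p‖ ^ 2 ≤ 3 * ε := by
    refine (norm_sub_sq_le_norm_mul_self_sub (CFC.abs_nonneg _) (star_mul_self_nonneg u)).trans ?_
    have : y * y - p * p = star u * e + e * u + e * e := by
      rw [CFC.abs_mul_abs, hpp, star_add, hes]; simp only [mul_add, add_mul]; simp only [p]; abel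
    rw [this]
    have b1 : ‖star u * e‖ ≤ 1 * ε := by
      refine (norm_mul_le _ _).trans ?_; rw [norm_star]; gcongr
    have b2 : ‖e * u‖ ≤ ε * 1 := (norm_mul_le _ _).trans (by gcongr)
    have b3 : ‖e * e‖ ≤ ε * ε := (norm_mul_le _ _).trans (by gcongr)
    refine (norm_add₃_le).trans ?_
    nlinarith
  have h2 : ‖y - p‖ < 1 / 5 := by nlinarith [norm_nonneg (y - p)]
  have h3 : σ * p - u = e - σ * (y - p) := by
    have := hσx
    rw [mul_sub, ← this]; abel
  have h4 : ‖σ * (y - p)‖ ≤ 1 * ‖y - p‖ := (norm_mul_le _ _).trans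
    (by gcongr; exact norm_le_one_of_mem_unitary hσ)
  have hlt : ‖σ * p - u‖ < 1 / 3 := by
    rw [h3]
    calc _ ≤ ‖e‖ + ‖σ * (y - p)‖ := norm_sub_le _ _
      _ < 1 / 3 := by linarith
  obtain ⟨τ, hτ, hτu, hc⟩ := exists_unitary_extending_of_norm_lt hu hσ hlt
  refine ⟨τ, hτ, hτu, fun c h1 h2 => hc c h1 h2 (hcσ c h1 h2) ?_⟩
  have := (hcσ (star c) (by simpa using h2.star_star) h1.star_star).star_star
  rwa [star_star] at this

end CStarAlgebra

/-! ### Unitaries between families with close Gram matrices -/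

namespace ContinuousLinearMap

variable {K : Type*} [NormedAddCommGroup K] [InnerProductSpace ℂ K] [CompleteSpace K]

/-- A finite-rank operator has only finitely many eigenvalues, so it becomes invertible after adding
a suitable arbitrarily small positive scalar. -/
theorem exists_isUnit_add_algebraMap (T : K →L[ℂ] K)
    [FiniteDimensional ℂ (LinearMap.range T.toLinearMap)] (δ : ℝ) (hδ : 0 < δ) :
    ∃ ε : ℝ, 0 < ε ∧ ε < δ ∧ IsUnit (T + algebraMap ℂ (K →L[ℂ] K) ε) := by
  set R := LinearMap.range T.toLinearMap
  have hcpt : IsCompactOperator T := by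
    have h1 : IsCompactOperator (R.subtypeL : R → K) := by
      have : ProperSpace R := FiniteDimensional.proper ℂ R
      exact isCompactOperator_of_locallyCompactSpace_rng R.subtypeL
    exact h1.comp_clm (T.codRestrict R fun x => ⟨x, rfl⟩)
  let f : Module.End ℂ R := T.toLinearMap.restrict (p := R) (q := R) fun x _ => ⟨x, rfl⟩
  have hfin : {ε : ℝ | f.HasEigenvalue (-(ε : ℂ))}.Finite := by
    refine (Module.End.finite_hasEigenvalue f).preimage (f := fun ε : ℝ => -(ε : ℂ)) ?_
    intro x _ y _ h
    simpa using h
  obtain ⟨ε, hε, hε'⟩ := (Set.Ioo_infinite hδ).exists_notMem_finite hfin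
  refine ⟨ε, hε.1, hε.2, ?_⟩
  have hε0 : -(ε : ℂ) ≠ 0 := by simpa using hε.1.ne'
  rcases hcpt.hasEigenvalue_or_mem_resolventSet hε0 with h | h
  · exfalso
    obtain ⟨x, hx⟩ := h.exists_hasEigenvector
    have hTx : T x = -(ε : ℂ) • x := hx.apply_eq_smul
    have hxR : x ∈ R := by
      refine ⟨(-(ε : ℂ))⁻¹ • x, ?_⟩
      simp only [map_smul, coe_coe]
      rw [hTx, inv_smul_smul₀ hε0]
    refine hε' (Module.End.hasEigenvalue_of_hasEigenvector (x := ⟨x, hxR⟩) ⟨?_, ?_⟩)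
    · rw [Module.End.mem_eigenspace_iff]
      exact Subtype.ext hTx
    · exact fun h0 => hx.2 (congrArg Subtype.val h0)
  · rw [spectrum.mem_resolventSet_iff] at h
    have := h.neg
    rwa [neg_sub, map_neg, sub_neg_eq_add] at this

end ContinuousLinearMap

namespace InnerProductSpace

variable {K : Type*} [NormedAddCommGroup K] [InnerProductSpace ℂ K]
  {ι : Type*} [Fintype ι]

/-- The operator `∑ₖ |xₖ⟩⟨yₖ|` of two finite families of vectors. -/
noncomputable def sumRankOne (x y : ι → K) : K →L[ℂ] K := ∑ k, rankOne ℂ (x k) (y k)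

theorem norm_sumRankOne_le {x y : ι → K} (hx : ∀ k, ‖x k‖ ≤ 1) (hy : ∀ k, ‖y k‖ ≤ 1) :
    ‖sumRankOne x y‖ ≤ Fintype.card ι := by
  refine (norm_sum_le _ _).trans ?_
  calc _ ≤ ∑ _k : ι, (1 : ℝ) := Finset.sum_le_sum fun k _ => by
        rw [norm_rankOne]; exact mul_le_one₀ (hx k) (norm_nonneg _) (hy k)
    _ = _ := by simp

theorem sumRankOne_mul_sumRankOne (x y z t : ι → K) :
    sumRankOne x y * sumRankOne z t
      = ∑ k, ∑ l, ⟪y k, z l⟫_ℂ • rankOne ℂ (x k) (t l) := by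
  simp only [sumRankOne, Finset.sum_mul, Finset.mul_sum]
  rw [Finset.sum_comm]
  refine Finset.sum_congr rfl fun k _ => Finset.sum_congr rfl fun l _ => ?_
  rw [ContinuousLinearMap.mul_def, rankOne_comp_rankOne]

instance finiteDimensional_range_sumRankOne (x y : ι → K) :
    FiniteDimensional ℂ (LinearMap.range (sumRankOne x y).toLinearMap) := by
  have h : LinearMap.range (sumRankOne x y).toLinearMap ≤ Submodule.span ℂ (Set.range x) := by
    rintro _ ⟨z, rfl⟩
    simp only [sumRankOne, ContinuousLinearMap.coe_coe, _root_.sum_apply,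
      rankOne_apply]
    exact Submodule.sum_mem _ fun k _ => Submodule.smul_mem _ _ (Submodule.subset_span ⟨k, rfl⟩)
  have : FiniteDimensional ℂ (Submodule.span ℂ (Set.range x)) :=
    FiniteDimensional.span_of_finite ℂ (Set.finite_range x)
  exact Submodule.finiteDimensional_of_le h

/-- The product `(∑ₖ |xₖ⟩⟨yₖ|) (∑ₗ |yₗ⟩⟨xₗ|)` depends on the family `y` only through its Gram
matrix, and continuously so. -/
theorem norm_sumRankOne_mul_sub_le {x y z : ι → K} {δ : ℝ} (hx : ∀ k, ‖x k‖ ≤ 1)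
    (h : ∀ k l, ‖⟪y k, y l⟫_ℂ - ⟪z k, z l⟫_ℂ‖ ≤ δ) :
    ‖sumRankOne x y * sumRankOne y x - sumRankOne x z * sumRankOne z x‖
      ≤ (Fintype.card ι : ℝ) ^ 2 * δ := by
  rw [sumRankOne_mul_sumRankOne, sumRankOne_mul_sumRankOne, ← Finset.sum_sub_distrib]
  calc _ ≤ ∑ _k : ι, ∑ _l : ι, δ := by
        refine (norm_sum_le _ _).trans (Finset.sum_le_sum fun k _ => ?_)
        rw [← Finset.sum_sub_distrib]
        refine (norm_sum_le _ _).trans (Finset.sum_le_sum fun l _ => ?_)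
        rw [← sub_smul, norm_smul, norm_rankOne]
        exact (mul_le_of_le_one_right (norm_nonneg _)
          (mul_le_one₀ (hx k) (norm_nonneg _) (hx l))).trans (h k l)
    _ = _ := by simp; ring

theorem mul_sumRankOne (c : K →L[ℂ] K) (x y : ι → K) :
    c * sumRankOne x y = sumRankOne (fun k => c (x k)) y := by
  simp [sumRankOne, Finset.mul_sum, ContinuousLinearMap.mul_def, comp_rankOne]

variable [CompleteSpace K]

theorem star_sumRankOne (x y : ι → K) : star (sumRankOne x y) = sumRankOne y x := by
  simp [sumRankOne, star_sum, ContinuousLinearMap.star_eq_adjoint]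

theorem sumRankOne_mul_star (c : K →L[ℂ] K) (x y : ι → K) :
    sumRankOne x y * star c = sumRankOne x fun k => c (y k) := by
  rw [← star_star (sumRankOne x y), ← star_mul, star_sumRankOne, mul_sumRankOne, star_sumRankOne]

theorem sumRankOne_self_nonneg (x : ι → K) : 0 ≤ sumRankOne x x :=
  Finset.sum_nonneg fun k _ =>
    (ContinuousLinearMap.nonneg_iff_isPositive _).2 (isPositive_rankOne_self (x k))

theorem norm_sq_le_norm_sumRankOne (x : ι → K) (k : ι) : ‖x k‖ ^ 2 ≤ ‖sumRankOne x x‖ := by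
  have h0 : ∀ l, 0 ≤ rankOne ℂ (x l) (x l) := fun l =>
    (ContinuousLinearMap.nonneg_iff_isPositive _).2 (isPositive_rankOne_self (x l))
  have h : rankOne ℂ (x k) (x k) ≤ sumRankOne x x :=
    Finset.single_le_sum (f := fun l => rankOne ℂ (x l) (x l)) (fun l _ => h0 l) (Finset.mem_univ k)
  have := CStarAlgebra.norm_le_norm_of_nonneg_of_le (h0 k) h
  rwa [norm_rankOne, ← pow_two] at this

theorem commute_sumRankOne {c : K →L[ℂ] K} (hc : c ∈ unitary (K →L[ℂ] K)) (e : Equiv.Perm ι)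
    {x y : ι → K} (hx : ∀ k, c (x k) = x (e k)) (hy : ∀ k, c (y k) = y (e k)) :
    Commute c (sumRankOne x y) := by
  have h1 : c * sumRankOne x y * star c = sumRankOne x y := by
    rw [mul_sumRankOne, sumRankOne_mul_star]
    simp only [hx, hy, sumRankOne]
    exact Equiv.sum_comp e fun k => rankOne ℂ (x k) (y k)
  calc c * sumRankOne x y = c * sumRankOne x y * (star c * c) := by
        rw [Unitary.star_mul_self_of_mem hc, mul_one]
    _ = sumRankOne x y * c := by rw [← mul_assoc, h1]

/-- Two finite families with nearly equal Gram matrices are nearly conjugate by a unitary, which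
can be chosen in the commutant of the unitaries that permute both families in the same way. The
unitary is the polar part of a small perturbation of `T = ∑ₖ |wₖ⟩⟨vₖ|`: if the Gram matrices agree,
then `T* T = (∑ₖ |vₖ⟩⟨vₖ|)²` and `T T* = (∑ₖ |wₖ⟩⟨wₖ|)²`. -/
theorem exists_unitary_norm_sub_sq_le {v w : ι → K} {δ r : ℝ} (hv : ∀ k, ‖v k‖ ≤ 1)
    (hw : ∀ k, ‖w k‖ ≤ 1) (h : ∀ k l, ‖⟪v k, v l⟫_ℂ - ⟪w k, w l⟫_ℂ‖ ≤ δ) (hr : 0 < r)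
    (hδ : (Fintype.card ι : ℝ) ^ 2 * δ < r ^ 2) :
    ∃ σ ∈ unitary (K →L[ℂ] K), (∀ c ∈ unitary (K →L[ℂ] K),
      (∃ e : Equiv.Perm ι, ∀ k, c (v k) = v (e k) ∧ c (w k) = w (e k)) → Commute c σ) ∧
      ∀ k, ‖σ (v k) - w k‖ ^ 2 ≤ 3 * r := by
  set N : ℝ := (Fintype.card ι : ℝ)
  have hN : 0 ≤ N := Nat.cast_nonneg _
  set T := sumRankOne w v with hT
  obtain ⟨η, hη, hη1, hη2⟩ : ∃ η : ℝ, 0 < η ∧ η < r / 2 ∧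
      N ^ 2 * δ + (2 * N * η + η * η) ≤ r ^ 2 := by
    set s := r ^ 2 - N ^ 2 * δ
    have hs : 0 < s := sub_pos.2 hδ
    have hd : 0 < 2 * N + 1 := by linarith
    refine ⟨min (r / 4) (min 1 (s / (2 * N + 1))), ?_, ?_, ?_⟩
    · positivity
    · exact (min_le_left _ _).trans_lt (by linarith)
    · set m := min (r / 4) (min 1 (s / (2 * N + 1)))
      have hm0 : 0 < m := by positivity
      have h1 : m ≤ 1 := (min_le_right _ _).trans (min_le_left _ _)
      have h2 : m ≤ s / (2 * N + 1) := (min_le_right _ _).trans (min_le_right _ _)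
      rw [le_div_iff₀ hd] at h2
      have : m * m ≤ m := mul_le_of_le_one_left hm0.le h1
      simp only [s] at h2
      linarith
  obtain ⟨ε, hε, hεη, hunit⟩ := T.exists_isUnit_add_algebraMap η hη
  obtain ⟨σ, hσ, hσx, hcomm⟩ := CStarAlgebra.exists_unitary_mul_abs hunit
  set E := algebraMap ℂ (K →L[ℂ] K) ε with hE
  have hEs : star E = E := by
    rw [hE, Algebra.algebraMap_eq_smul_one, star_smul, star_one, RCLike.star_def,
      Complex.conj_ofReal]
  have hcE : ∀ c : K →L[ℂ] K, c * E = E * c := fun c => (Algebra.commutes (ε : ℂ) c).symm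
  have hEn : ‖E‖ ≤ ε := by
    rw [hE, Algebra.algebraMap_eq_smul_one, norm_smul, Complex.norm_real, Real.norm_of_nonneg hε.le]
    exact mul_le_of_le_one_right hε.le ContinuousLinearMap.norm_id_le
  set y := CFC.abs (T + E) with hy
  have hy0 : 0 ≤ y := CFC.abs_nonneg _
  have hys : star y = y := IsSelfAdjoint.of_nonneg hy0
  have hTs : star T = sumRankOne v w := star_sumRankOne _ _
  have hTn : ‖T‖ ≤ N := norm_sumRankOne_le hw hv
  have hTsn : ‖star T‖ ≤ N := (norm_star T).trans_le hTn
  have hσ1 : star σ * σ = 1 := Unitary.star_mul_self_of_mem hσ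
  have hσn : ‖σ‖ ≤ 1 := CStarAlgebra.norm_le_one_of_mem_unitary hσ
  have hσn' : ‖star σ‖ ≤ 1 := (norm_star σ).trans_le hσn
  have hsmall : ‖star T * E + E * T + E * E‖ ≤ 2 * N * η + η * η := by
    have b1 : ‖star T * E‖ ≤ N * η := (norm_mul_le _ _).trans (by gcongr; linarith)
    have b2 : ‖E * T‖ ≤ η * N := (norm_mul_le _ _).trans (by gcongr; linarith)
    have b3 : ‖E * E‖ ≤ η * η := (norm_mul_le _ _).trans (by gcongr <;> linarith)
    exact norm_add₃_le.trans (by linarith)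
  have hsmall' : ‖T * E + E * star T + E * E‖ ≤ 2 * N * η + η * η := by
    have b1 : ‖T * E‖ ≤ N * η := (norm_mul_le _ _).trans (by gcongr; linarith)
    have b2 : ‖E * star T‖ ≤ η * N := (norm_mul_le _ _).trans (by gcongr; linarith)
    have b3 : ‖E * E‖ ≤ η * η := (norm_mul_le _ _).trans (by gcongr <;> linarith)
    exact norm_add₃_le.trans (by linarith)
  have h1 : ‖sumRankOne v v - y‖ ≤ r := by
    have e : sumRankOne v v * sumRankOne v v - y * y
        = (sumRankOne v v * sumRankOne v v - sumRankOne v w * sumRankOne w v)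
          - (star T * E + E * T + E * E) := by
      rw [hy, CFC.abs_mul_abs, star_add, hEs, hTs, mul_add, add_mul, add_mul, ← hT]
      abel
    have b : ‖sumRankOne v v - y‖ ^ 2 ≤ r ^ 2 := by
      refine (CStarAlgebra.norm_sub_sq_le_norm_mul_self_sub (sumRankOne_self_nonneg v) hy0).trans ?_
      rw [e]
      exact (norm_sub_le _ _).trans
        ((add_le_add (norm_sumRankOne_mul_sub_le hv h) hsmall).trans hη2)
    exact (sq_le_sq₀ (norm_nonneg _) hr.le).1 b
  have h2 : ‖sumRankOne w w - σ * y * star σ‖ ≤ r := by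
    have e : sumRankOne w w * sumRankOne w w - (σ * y * star σ) * (σ * y * star σ)
        = (sumRankOne w w * sumRankOne w w - sumRankOne w v * sumRankOne v w)
          - (T * E + E * star T + E * E) := by
      have : (σ * y * star σ) * (σ * y * star σ) = (T + E) * star (T + E) := by
        calc _ = σ * y * (star σ * σ) * y * star σ := by simp only [mul_assoc]
          _ = (σ * y) * star (σ * y) := by rw [hσ1, star_mul, hys]; simp only [mul_assoc, one_mul]
          _ = _ := by rw [← hσx]
      rw [this, star_add, hEs, hTs, mul_add, add_mul, add_mul, ← hT]
      abel
    have b : ‖sumRankOne w w - σ * y * star σ‖ ^ 2 ≤ r ^ 2 := by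
      refine (CStarAlgebra.norm_sub_sq_le_norm_mul_self_sub (sumRankOne_self_nonneg w)
        (star_right_conjugate_nonneg hy0 σ)).trans ?_
      rw [e]
      refine (norm_sub_le _ _).trans
        ((add_le_add (norm_sumRankOne_mul_sub_le hw ?_) hsmall').trans hη2)
      intro k l
      rw [norm_sub_rev]
      exact h k l
    exact (sq_le_sq₀ (norm_nonneg _) hr.le).1 b
  refine ⟨σ, hσ, ?_, ?_⟩
  · rintro c hc ⟨e, he⟩
    have c1 := commute_sumRankOne hc e (fun k => (he k).2) (fun k => (he k).1)
    have c2 := commute_sumRankOne hc e (fun k => (he k).1) (fun k => (he k).2)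
    refine hcomm c (c1.add_right (hcE c)) ?_
    rw [star_add, hEs, hTs]
    exact c2.add_right (hcE c)
  · intro k
    have e : sumRankOne (fun k => σ (v k) - w k) (fun k => σ (v k) - w k)
        = σ * (sumRankOne v v - y) * star σ + (sumRankOne w w - σ * y * star σ)
          + (E * star σ + σ * E) := by
      have e1 : sumRankOne (fun k => σ (v k) - w k) (fun k => σ (v k) - w k)
          = σ * sumRankOne v v * star σ - σ * star T - T * star σ + sumRankOne w w := by
        rw [hTs, hT, mul_sumRankOne, mul_sumRankOne, sumRankOne_mul_star, sumRankOne_mul_star]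
        simp only [sumRankOne, map_sub, _root_.sub_apply, Finset.sum_sub_distrib]
        abel
      have e2 : T * star σ = σ * y * star σ - E * star σ := by
        rw [← hσx]; simp only [add_mul]; abel
      have e3 : σ * star T = σ * y * star σ - σ * E := by
        have : star T = y * star σ - E := by
          have := congrArg star hσx
          rw [star_add, star_mul, hys, hEs] at this
          rw [← this]; abel
        rw [this]; simp only [mul_sub, mul_assoc]
      rw [e1, e2, e3]
      simp only [mul_sub, sub_mul]
      abel
    refine (norm_sq_le_norm_sumRankOne (fun k => σ (v k) - w k) k).trans ?_
    rw [e]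
    have b1 : ‖σ * (sumRankOne v v - y) * star σ‖ ≤ 1 * r * 1 :=
      norm_mul₃_le.trans (by gcongr)
    have b2 : ‖E * star σ‖ ≤ ε * 1 := (norm_mul_le _ _).trans (by gcongr)
    have b3 : ‖σ * E‖ ≤ 1 * ε := (norm_mul_le _ _).trans (by gcongr)
    have b4 : ‖E * star σ + σ * E‖ ≤ r := (norm_add_le _ _).trans (by linarith)
    exact norm_add₃_le.trans (by linarith)

end InnerProductSpace

/-! ### Unitaries between families with equal Gram matrices -/

namespace InnerProductSpace

variable {ι : Type*}

theorem norm_linearCombination_eq_of_inner_eq {E F : Type*} [NormedAddCommGroup E]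
    [InnerProductSpace ℂ E] [NormedAddCommGroup F] [InnerProductSpace ℂ F]
    {v : ι → E} {w : ι → F} (h : ∀ k l, ⟪v k, v l⟫_ℂ = ⟪w k, w l⟫_ℂ) (c : ι →₀ ℂ) :
    ‖Finsupp.linearCombination ℂ w c‖ = ‖Finsupp.linearCombination ℂ v c‖ := by
  rw [@norm_eq_sqrt_re_inner ℂ, @norm_eq_sqrt_re_inner ℂ]
  congr 2
  simp only [Finsupp.linearCombination_apply, Finsupp.sum, sum_inner, inner_sum, inner_smul_left,
    inner_smul_right, h]

/-- Families with the same Gram matrix and dense spans are related by a linear isometric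
equivalence. -/
theorem exists_linearIsometryEquiv_of_inner_eq {E F : Type*} [NormedAddCommGroup E]
    [InnerProductSpace ℂ E] [CompleteSpace E] [NormedAddCommGroup F] [InnerProductSpace ℂ F]
    [CompleteSpace F] {v : ι → E} {w : ι → F}
    (hv : (Submodule.span ℂ (Set.range v)).topologicalClosure = ⊤)
    (hw : (Submodule.span ℂ (Set.range w)).topologicalClosure = ⊤)
    (h : ∀ k l, ⟪v k, v l⟫_ℂ = ⟪w k, w l⟫_ℂ) :
    ∃ L : E ≃ₗᵢ[ℂ] F, ∀ k, L (v k) = w k := by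
  have dv : DenseRange (Finsupp.linearCombination ℂ v) := by
    rw [DenseRange, ← LinearMap.coe_range, Finsupp.range_linearCombination]
    exact (Submodule.dense_iff_topologicalClosure_eq_top).2 hv
  have dw : DenseRange (Finsupp.linearCombination ℂ w) := by
    rw [DenseRange, ← LinearMap.coe_range, Finsupp.range_linearCombination]
    exact (Submodule.dense_iff_topologicalClosure_eq_top).2 hw
  refine ⟨(LinearEquiv.refl ℂ (ι →₀ ℂ)).extendOfIsometry _ _ dv dw fun c =>
    norm_linearCombination_eq_of_inner_eq h c, fun k => ?_⟩
  have := LinearEquiv.extendOfIsometry_eq (LinearEquiv.refl ℂ (ι →₀ ℂ)) _ _ dv dw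
    (fun c => norm_linearCombination_eq_of_inner_eq h c) (Finsupp.single k 1)
  simpa using this

variable {K : Type*} [NormedAddCommGroup K] [InnerProductSpace ℂ K] [CompleteSpace K]

/-- For finite families with the same Gram matrix, the partial isometry that carries one span
onto the other and vanishes on the orthogonal complement of the first. -/
theorem exists_partialIsometry_of_inner_eq [Finite ι] {v w : ι → K}
    (h : ∀ k l, ⟪v k, v l⟫_ℂ = ⟪w k, w l⟫_ℂ) :
    ∃ u : K →L[ℂ] K, u * star u * u = u ∧ (∀ k, u (v k) = w k) ∧
      (∀ k, (star u * u) (v k) = v k) ∧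
      (∀ x, (star u * u) x ∈ Submodule.span ℂ (Set.range v)) ∧
      (∀ x, (∀ k, ⟪v k, x⟫_ℂ = 0) → u x = 0) ∧
      FiniteDimensional ℂ (LinearMap.range u.toLinearMap) := by
  have fin : ∀ z : ι → K, FiniteDimensional ℂ (Submodule.span ℂ (Set.range z)) := fun z =>
    FiniteDimensional.span_of_finite ℂ (Set.finite_range z)
  set V := Submodule.span ℂ (Set.range v) with hV
  set W := Submodule.span ℂ (Set.range w) with hW
  have : FiniteDimensional ℂ V := fin v
  have : FiniteDimensional ℂ W := fin w
  have cV : CompleteSpace V := FiniteDimensional.complete ℂ V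
  have cW : CompleteSpace W := FiniteDimensional.complete ℂ W
  have top : ∀ z : ι → K, (Submodule.span ℂ (Set.range fun k =>
      (⟨z k, Submodule.subset_span ⟨k, rfl⟩⟩ : Submodule.span ℂ (Set.range z)))).topologicalClosure
        = ⊤ := by
    intro z
    rw [eq_top_iff, ← Submodule.span_span_coe_preimage (R := ℂ) (s := Set.range z)]
    refine le_trans (Submodule.span_mono ?_) (Submodule.le_topologicalClosure _)
    rintro ⟨x, hx⟩ ⟨k, rfl⟩
    exact ⟨k, rfl⟩
  obtain ⟨L, hL⟩ := exists_linearIsometryEquiv_of_inner_eq (top v) (top w) fun k l => h k l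
  set P := V.orthogonalProjectionOnto
  set u : K →L[ℂ] K := W.subtypeL ∘L (L.toContinuousLinearEquiv : V →L[ℂ] W) ∘L P with hu
  have hux : ∀ x, u x = L (P x) := fun x => rfl
  have hPV : ∀ x : V, P x = x := fun x => Submodule.orthogonalProjectionOnto_mem_subspace_eq_self x
  have hvk : ∀ k, P (v k) = ⟨v k, Submodule.subset_span ⟨k, rfl⟩⟩ := fun k =>
    hPV ⟨v k, Submodule.subset_span ⟨k, rfl⟩⟩
  have hstar : star u * u = V.subtypeL ∘L P := by
    refine ContinuousLinearMap.ext fun x => ext_inner_left ℂ fun y => ?_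
    rw [mul_apply_eq_comp, ContinuousLinearMap.star_eq_adjoint,
      ContinuousLinearMap.adjoint_inner_right, hux, hux, ← Submodule.coe_inner, L.inner_map_map]
    simp only [ContinuousLinearMap.comp_apply, Submodule.subtypeL_apply]
    exact (Submodule.inner_orthogonalProjectionOnto_eq_of_mem_right (P x) y)
  refine ⟨u, ?_, ?_, ?_, ?_, ?_, ?_⟩
  · rw [mul_assoc, hstar]
    refine ContinuousLinearMap.ext fun x => ?_
    simp only [mul_apply_eq_comp, ContinuousLinearMap.comp_apply,
      Submodule.subtypeL_apply, hux, hPV]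
  · intro k
    rw [hux, hvk, hL]
  · intro k
    rw [hstar]
    simp only [ContinuousLinearMap.comp_apply, Submodule.subtypeL_apply, hvk]
  · intro x
    rw [hstar]
    exact (P x).2
  · intro x hx
    rw [hux]
    have : P x = 0 := by
      rw [Submodule.orthogonalProjectionOnto_eq_zero_iff, Submodule.mem_orthogonal]
      intro y hy
      induction hy using Submodule.span_induction with
      | mem y hy => obtain ⟨k, rfl⟩ := hy; exact hx k
      | zero => simp
      | add y z _ _ h1 h2 => rw [inner_add_left, h1, h2, add_zero]
      | smul c y _ h1 => rw [inner_smul_left, h1, mul_zero]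
    simp [this]
  · refine Submodule.finiteDimensional_of_le (S₂ := W) ?_
    rintro _ ⟨x, rfl⟩
    exact (L (P x)).2

/-- Finite families with the same Gram matrix are conjugate by a unitary in the commutant of the
unitaries that permute both families in the same way. -/
theorem exists_unitary_map_eq [Finite ι] {v w : ι → K}
    (h : ∀ k l, ⟪v k, v l⟫_ℂ = ⟪w k, w l⟫_ℂ) :
    ∃ τ ∈ unitary (K →L[ℂ] K), (∀ c ∈ unitary (K →L[ℂ] K),
      (∃ e : Equiv.Perm ι, ∀ k, c (v k) = v (e k) ∧ c (w k) = w (e k)) → Commute c τ) ∧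
      ∀ k, τ (v k) = w k := by
  obtain ⟨u, hu, huv, hpv, hpV, hu0, hfin⟩ := exists_partialIsometry_of_inner_eq h
  obtain ⟨τ, hτ, hτu, hcomm⟩ := CStarAlgebra.exists_unitary_extending hu fun δ hδ =>
    u.exists_isUnit_add_algebraMap δ hδ
  refine ⟨τ, hτ, ?_, fun k => ?_⟩
  · rintro c hc ⟨e, he⟩
    have hc1 : star c * c = 1 := Unitary.star_mul_self_of_mem hc
    have hc2 : c * star c = 1 := Unitary.mul_star_self_of_mem hc
    have hcu : c * u = u * c := by
      -- Both sides agree on the `vₖ` and vanish on their orthogonal complement.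
      set p := star u * u with hp
      have hup : u * p = u := by rw [hp, ← mul_assoc]; exact hu
      have key : ∀ x, (∀ k, ⟪v k, x⟫_ℂ = 0) → ∀ k, ⟪v k, c x⟫_ℂ = 0 := by
        intro x hx k
        have : v k = c (v (e.symm k)) := by rw [(he _).1, Equiv.apply_symm_apply]
        rw [this, ← ContinuousLinearMap.adjoint_inner_left, ← ContinuousLinearMap.star_eq_adjoint,
          ← mul_apply_eq_comp, hc1]
        exact hx _
      have hperp : ∀ x k, ⟪v k, x - p x⟫_ℂ = 0 := by
        intro x k
        have hps : star p = p := by simp [hp]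
        rw [inner_sub_right, ← ContinuousLinearMap.adjoint_inner_left,
          ← ContinuousLinearMap.star_eq_adjoint, hps, hpv, sub_self]
      have hspan : ∀ y ∈ Submodule.span ℂ (Set.range v), c (u y) = u (c y) := by
        intro y hy
        induction hy using Submodule.span_induction with
        | mem y hy =>
          obtain ⟨k, rfl⟩ := hy
          rw [huv, (he k).1, (he k).2, huv]
        | zero => simp
        | add y z _ _ h1 h2 => simp only [map_add, h1, h2]
        | smul a y _ h1 => simp only [map_smul, h1]
      refine ContinuousLinearMap.ext fun x => ?_
      have h1 : u x = u (p x) := by rw [← mul_apply_eq_comp, hup]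
      have h2 : u (c x) = u (c (p x)) := by
        have := hu0 _ (key _ (hperp x))
        rwa [map_sub, map_sub, sub_eq_zero] at this
      rw [mul_apply_eq_comp, mul_apply_eq_comp, h2, h1, hspan _ (hpV x)]
    have hcs : star u * star c = star c * star u := by
      rw [← star_mul, hcu, star_mul]
    refine hcomm c hcu ?_
    calc c * star u = c * (star u * star c) * c := by
          rw [mul_assoc, mul_assoc, hc1, mul_one]
      _ = star u * c := by rw [hcs, ← mul_assoc, hc2, one_mul]
  · rw [← huv, ← hτu, mul_apply_eq_comp, hpv]

end InnerProductSpace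

/-! ### Tuples in a unitary representation -/

namespace UnitaryRep

open InnerProductSpace

variable {G : Type*} [Group G] {K : Type*} [NormedAddCommGroup K]
  [InnerProductSpace ℂ K] [CompleteSpace K] (π : G →* unitary (K →L[ℂ] K)) {n : ℕ}

theorem inner_act_act (x y : K) (g h : G) :
    ⟪(π g : K →L[ℂ] K) x, (π h : K →L[ℂ] K) y⟫_ℂ = ⟪x, (π (g⁻¹ * h) : K →L[ℂ] K) y⟫_ℂ := by
  have h1 : (π h : K →L[ℂ] K) y = (π g : K →L[ℂ] K) ((π (g⁻¹ * h) : K →L[ℂ] K) y) := by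
    rw [← mul_apply_eq_comp, ← Submonoid.coe_mul, ← map_mul, mul_inv_cancel_left]
  rw [h1]
  exact ContinuousLinearMap.inner_map_map_of_mem_unitary (π g).2 _ _

theorem exists_perm_act (a b : Fin n → K) (h : G) : ∃ e : Equiv.Perm (G × Fin n), ∀ k,
    (π h : K →L[ℂ] K) ((π k.1 : K →L[ℂ] K) (a k.2)) = (π (e k).1 : K →L[ℂ] K) (a (e k).2) ∧
    (π h : K →L[ℂ] K) ((π k.1 : K →L[ℂ] K) (b k.2)) = (π (e k).1 : K →L[ℂ] K) (b (e k).2) := by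
  refine ⟨Equiv.prodCongr (Equiv.mulLeft h) (Equiv.refl _), fun k => ?_⟩
  simp only [Equiv.prodCongr_apply, Prod.map, Equiv.coe_mulLeft, Equiv.refl_apply, map_mul,
    Submonoid.coe_mul, mul_apply_eq_comp, and_self]

variable [Finite G]

/-- Tuples with the same inner products `⟨aᵢ, π(g) aⱼ⟩` are conjugate by a unitary operator
that commutes with the representation. -/
theorem exists_intertwiner_map_eq {a b : Fin n → K}
    (h : ∀ i j g, ⟪a i, (π g : K →L[ℂ] K) (a j)⟫_ℂ = ⟪b i, (π g : K →L[ℂ] K) (b j)⟫_ℂ) :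
    ∃ σ ∈ unitary (K →L[ℂ] K), (∀ g, Commute (π g : K →L[ℂ] K) σ) ∧ ∀ i, σ (a i) = b i := by
  obtain ⟨σ, hσ, hc, hm⟩ := exists_unitary_map_eq
    (v := fun k : G × Fin n => (π k.1 : K →L[ℂ] K) (a k.2))
    (w := fun k : G × Fin n => (π k.1 : K →L[ℂ] K) (b k.2))
    (fun k l => by rw [inner_act_act, inner_act_act, h])
  refine ⟨σ, hσ, fun g => hc _ (π g).2 (exists_perm_act π a b g), fun i => ?_⟩
  simpa using hm (1, i)

/-- Tuples in the unit ball with nearly the same inner products `⟨aᵢ, π(g) aⱼ⟩` are nearly conjugate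
by a unitary operator that commutes with the representation. -/
theorem exists_intertwiner_norm_sub_le (n : ℕ) {ε : ℝ} (hε : 0 < ε) : ∃ δ : ℝ, 0 < δ ∧
    ∀ a b : Fin n → K, (∀ i, ‖a i‖ ≤ 1) → (∀ i, ‖b i‖ ≤ 1) →
    (∀ i j g, ‖⟪a i, (π g : K →L[ℂ] K) (a j)⟫_ℂ - ⟪b i, (π g : K →L[ℂ] K) (b j)⟫_ℂ‖ ≤ δ) →
    ∃ σ ∈ unitary (K →L[ℂ] K), (∀ g, Commute (π g : K →L[ℂ] K) σ) ∧
      ∀ i, ‖σ (a i) - b i‖ ≤ ε := by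
  have := Fintype.ofFinite G
  set N : ℝ := (Fintype.card (G × Fin n) : ℝ)
  set r := ε ^ 2 / 3
  have hr : 0 < r := by positivity
  have hN : 0 < N ^ 2 + 1 := by positivity
  refine ⟨r ^ 2 / (N ^ 2 + 1), by positivity, fun a b ha hb h => ?_⟩
  have hn : ∀ g (x : K), ‖x‖ ≤ 1 → ‖(π g : K →L[ℂ] K) x‖ ≤ 1 := fun g x hx => by
    rwa [ContinuousLinearMap.norm_map_of_mem_unitary (π g).2]
  obtain ⟨σ, hσ, hc, hm⟩ := exists_unitary_norm_sub_sq_le (r := r) (δ := r ^ 2 / (N ^ 2 + 1))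
    (v := fun k : G × Fin n => (π k.1 : K →L[ℂ] K) (a k.2))
    (w := fun k : G × Fin n => (π k.1 : K →L[ℂ] K) (b k.2))
    (fun k => hn _ _ (ha _)) (fun k => hn _ _ (hb _))
    (fun k l => by rw [inner_act_act, inner_act_act]; exact h _ _ _) hr
    (by
      change N ^ 2 * (r ^ 2 / (N ^ 2 + 1)) < r ^ 2
      rw [mul_div_assoc', div_lt_iff₀ hN]
      nlinarith [pow_pos hr 2])
  refine ⟨σ, hσ, fun g => hc _ (π g).2 (exists_perm_act π a b g), fun i => ?_⟩
  have h1 := hm (1, i)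
  simp only [map_one, Submonoid.coe_one, one_apply_eq_self] at h1
  refine (sq_le_sq₀ (norm_nonneg _) hε.le).1 (h1.trans_eq ?_)
  simp only [r]; ring

end UnitaryRep

/-! ### Formulas of continuous logic and transfer of universal conditions -/

namespace ContLogic

variable {L : Signature.{v}}

section Uniform

variable (M : Structure.{v, w} L)

theorem Structure.uniformContinuous_func {k : ℕ} (f : L.Func k) :
    UniformContinuous (M.func f) := by
  refine Metric.uniformContinuous_iff.2 fun ε hε => ?_
  refine ⟨L.funcModulus f (ε / 2), L.funcModulus_pos f _ (half_pos hε), fun {a b} h => ?_⟩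
  exact (M.func_modulus f _ (half_pos hε) a b h).trans_lt (half_lt_self hε)

theorem Structure.uniformContinuous_pred {k : ℕ} (P : L.Pred k) :
    UniformContinuous (M.pred P) := by
  refine Metric.uniformContinuous_iff.2 fun ε hε => ?_
  refine ⟨L.predModulus P (ε / 2), L.predModulus_pos P _ (half_pos hε), fun {a b} h => ?_⟩
  exact (M.pred_modulus P _ (half_pos hε) a b h).trans_lt (half_lt_self hε)

theorem Term.uniformContinuous_eval {n : ℕ} (t : Term L n) :
    UniformContinuous fun a : Fin n → M.Carrier => t.eval M a := by
  induction t with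
  | var i => exact Pi.uniformContinuous_proj _ i
  | app f ts ih => exact (M.uniformContinuous_func f).comp (uniformContinuous_pi.2 ih)

theorem Formula.le_ciSup_eval {n : ℕ} (φ : Formula L (n + 1)) (a : Fin n → M.Carrier)
    (x : M.Carrier) : φ.eval M (Fin.snoc a x) ≤ ⨆ y, φ.eval M (Fin.snoc a y) := by
  obtain ⟨C, hC⟩ := φ.exists_abs_eval_le M
  exact le_ciSup (f := fun y => φ.eval M (Fin.snoc a y))
    ⟨C, by rintro _ ⟨y, rfl⟩; exact (abs_le.1 (hC _)).2⟩ x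

theorem Formula.ciInf_eval_le {n : ℕ} (φ : Formula L (n + 1)) (a : Fin n → M.Carrier)
    (x : M.Carrier) : ⨅ y, φ.eval M (Fin.snoc a y) ≤ φ.eval M (Fin.snoc a x) := by
  obtain ⟨C, hC⟩ := φ.exists_abs_eval_le M
  exact ciInf_le (f := fun y => φ.eval M (Fin.snoc a y))
    ⟨-C, by rintro _ ⟨y, rfl⟩; exact (abs_le.1 (hC _)).1⟩ x

theorem dist_snoc_lt {X : Type*} [PseudoMetricSpace X] {n : ℕ} {a b : Fin n → X} (x : X) {δ : ℝ}
    (hδ : 0 < δ) (h : dist a b < δ) :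
    dist (Fin.snoc a x : Fin (n + 1) → X) (Fin.snoc b x) < δ := by
  refine (dist_pi_lt_iff hδ).2 fun i => ?_
  refine Fin.lastCases ?_ (fun j => ?_) i
  · simpa using hδ
  · simpa using (dist_le_pi_dist a b j).trans_lt h

/-- Every formula is uniformly continuous in every structure. -/
theorem Formula.uniformContinuous_eval {n : ℕ} (φ : Formula L n) :
    UniformContinuous fun a : Fin n → M.Carrier => φ.eval M a := by
  induction φ with
  | dist s t => exact (s.uniformContinuous_eval M).dist (t.uniformContinuous_eval M)
  | pred P ts =>
    exact (M.uniformContinuous_pred P).comp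
      (uniformContinuous_pi.2 fun i => (ts i).uniformContinuous_eval M)
  | conn c φ ih =>
    choose C hC using fun i => (φ i).exists_abs_eval_le M
    have hK : IsCompact (Set.univ.pi fun i => Set.Icc (-C i) (C i)) :=
      isCompact_univ_pi fun i => isCompact_Icc
    have h1 := hK.uniformContinuousOn_of_continuous c.continuous.continuousOn
    exact h1.comp (uniformContinuous_pi.2 ih).uniformContinuousOn
      (fun a _ i _ => abs_le.1 (hC i a)) |> uniformContinuousOn_univ.1
  | sup φ ih =>
    refine Metric.uniformContinuous_iff.2 fun ε hε => ?_
    obtain ⟨δ, hδ, h⟩ := Metric.uniformContinuous_iff.1 ih (ε / 2) (half_pos hε)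
    refine ⟨δ, hδ, fun {a b} hab => ?_⟩
    have key : ∀ {a b : Fin _ → M.Carrier}, Dist.dist a b < δ →
        (⨆ x, φ.eval M (Fin.snoc a x)) ≤ (⨆ x, φ.eval M (Fin.snoc b x)) + ε / 2 := by
      intro a b hab
      refine ciSup_le fun x => ?_
      have := (abs_lt.1 (h (dist_snoc_lt x hδ hab))).2
      linarith [φ.le_ciSup_eval M b x]
    rw [Real.dist_eq, abs_lt]
    simp only [Formula.eval]
    constructor
    · linarith [key (dist_comm a b ▸ hab)]
    · linarith [key hab]
  | inf φ ih =>
    refine Metric.uniformContinuous_iff.2 fun ε hε => ?_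
    obtain ⟨δ, hδ, h⟩ := Metric.uniformContinuous_iff.1 ih (ε / 2) (half_pos hε)
    refine ⟨δ, hδ, fun {a b} hab => ?_⟩
    have key : ∀ {a b : Fin _ → M.Carrier}, Dist.dist a b < δ →
        (⨅ x, φ.eval M (Fin.snoc a x)) - ε / 2 ≤ (⨅ x, φ.eval M (Fin.snoc b x)) := by
      intro a b hab
      refine le_ciInf fun x => ?_
      have := (abs_lt.1 (h (dist_snoc_lt x hδ hab))).2
      linarith [φ.ciInf_eval_le M a x]
    rw [Real.dist_eq, abs_lt]
    simp only [Formula.eval]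
    constructor
    · linarith [key (dist_comm a b ▸ hab)]
    · linarith [key hab]

end Uniform

section Automorphism

variable {M : Structure.{v, w} L} (σ : Automorphism M)

theorem Automorphism.eval_term {n : ℕ} (t : Term L n) (a : Fin n → M.Carrier) :
    t.eval M (fun i => σ.toIsometryEquiv (a i)) = σ.toIsometryEquiv (t.eval M a) := by
  induction t with
  | var i => rfl
  | app f ts ih => simp only [Term.eval, ih, σ.map_func]

theorem Automorphism.eval_formula {n : ℕ} (φ : Formula L n) (a : Fin n → M.Carrier) :
    φ.eval M (fun i => σ.toIsometryEquiv (a i)) = φ.eval M a := by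
  have hsnoc : ∀ {n : ℕ} (a : Fin n → M.Carrier) (x : M.Carrier),
      (Fin.snoc (fun i => σ.toIsometryEquiv (a i)) (σ.toIsometryEquiv x) : Fin (n + 1) → M.Carrier)
        = fun i => σ.toIsometryEquiv ((Fin.snoc a x : Fin (n + 1) → M.Carrier) i) := by
    intro n a x
    funext i
    refine Fin.lastCases ?_ (fun j => ?_) i <;> simp
  induction φ with
  | dist s t => simp only [Formula.eval, σ.eval_term, σ.toIsometryEquiv.dist_eq]
  | pred P ts => simp only [Formula.eval, σ.eval_term, σ.map_pred]
  | conn c φ ih => simp only [Formula.eval, ih]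
  | sup φ ih =>
    simp only [Formula.eval]
    rw [← σ.toIsometryEquiv.surjective.iSup_comp]
    simp only [hsnoc, ih]
  | inf φ ih =>
    simp only [Formula.eval]
    rw [← σ.toIsometryEquiv.surjective.iInf_comp]
    simp only [hsnoc, ih]

end Automorphism

/-- A continuous connective applied to a finite family of formulas. -/
noncomputable def Formula.connFamily {ι : Type*} [Fintype ι] {n : ℕ} (F : C(ι → ℝ, ℝ))
    (φ : ι → Formula L n) : Formula L n :=
  .conn (F.comp ⟨fun x i => x (Fintype.equivFin ι i), by fun_prop⟩)
    fun i => φ ((Fintype.equivFin ι).symm i)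

@[simp]
theorem Formula.eval_connFamily {ι : Type*} [Fintype ι] {n : ℕ} (F : C(ι → ℝ, ℝ))
    (φ : ι → Formula L n) (M : Structure.{v, w} L) (a : Fin n → M.Carrier) :
    (Formula.connFamily F φ).eval M a = F fun i => (φ i).eval M a := by
  simp [Formula.connFamily, Formula.eval]

theorem Formula.isQF_connFamily {ι : Type*} [Fintype ι] {n : ℕ} (F : C(ι → ℝ, ℝ))
    {φ : ι → Formula L n} (h : ∀ i, (φ i).IsQF) : (Formula.connFamily F φ).IsQF :=
  fun _ => h _

section Transfer

variable {M₀ : Structure.{v, u} L} {M : Structure.{v, w} L}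

/-- Universal conditions pass from a structure to the models of its theory. -/
theorem Theory.Model.eval_le_zero (hM : M₀.theory.Model M) {n : ℕ} (φ : Formula L n)
    (h : ∀ a, φ.eval M₀ a ≤ 0) (a : Fin n → M.Carrier) : φ.eval M a ≤ 0 := by
  induction n with
  | zero =>
    let ψ : Formula L 0 := .connFamily (ι := Unit) ⟨fun x => max (x ()) 0, by fun_prop⟩ fun _ => φ
    have h1 : ψ ∈ M₀.theory := by
      change ψ.eval M₀ Fin.elim0 = 0
      simpa [ψ] using h _
    have h2 : ψ.eval M Fin.elim0 = 0 := hM ψ h1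
    rw [Subsingleton.elim a Fin.elim0]
    simpa [ψ] using h2
  | succ n ih =>
    have h1 := ih (.sup φ) (fun b => by
      obtain ⟨x₀⟩ := M₀.nonempty
      have : Nonempty M₀.Carrier := ⟨x₀⟩
      exact ciSup_le fun x => h _) (Fin.init a)
    have h2 := φ.le_ciSup_eval M (Fin.init a) (a (Fin.last n))
    rw [Fin.snoc_init_self] at h2
    exact h2.trans h1

/-- Quantifier elimination for the complete theory of a structure only has to be checked in the
structure itself, since uniform approximation is a universal condition. -/
theorem Structure.theory_hasQuantifierElimination (M₀ : Structure.{v, u} L)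
    (h : ∀ (n : ℕ) (φ : Formula L n) (ε : ℝ), 0 < ε → ∃ ψ : Formula L n, ψ.IsQF ∧
      ∀ a : Fin n → M₀.Carrier, |φ.eval M₀ a - ψ.eval M₀ a| ≤ ε) :
    Theory.HasQuantifierElimination.{v, w} M₀.theory := by
  intro n φ ε hε
  obtain ⟨ψ, hψ, hφψ⟩ := h n φ ε hε
  refine ⟨ψ, hψ, fun M hM a => ?_⟩
  let χ : Formula L n := .connFamily (ι := Bool)
    ⟨fun x => |x true - x false| - ε, by fun_prop⟩ fun i => if i then φ else ψ
  have := hM.eval_le_zero χ (fun b => by simpa [χ] using hφψ b) a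
  simpa [χ] using this

/-- In tuples with the same quantifier-free type, quantifier-free formulas have the same values. -/
theorem Structure.eval_eq_of_qfType_eq {n : ℕ} {a b : Fin n → M.Carrier}
    (h : M.qfType a = M.qfType b) {φ : Formula L n} (hφ : φ.IsQF) :
    φ.eval M a = φ.eval M b := by
  let ψ : Formula L n := .connFamily (ι := Unit)
    ⟨fun x => x () - φ.eval M b, by fun_prop⟩ fun _ => φ
  have hb : ψ ∈ M.qfType b := ⟨Formula.isQF_connFamily _ fun _ => hφ, by simp [ψ]⟩
  rw [← h] at hb
  have := hb.2
  simp only [ψ, Formula.eval_connFamily, ContinuousMap.coe_mk] at this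
  linarith

end Transfer

end ContLogic

/-- If nearby values of `D` force nearby values of the bounded function `f`, then `f` is nearly a
continuous function of `D`. The witness is the McShane-type envelope
`y ↦ supₓ (f x - c · dist y (D x))` with a large Lipschitz constant `c`. -/
theorem exists_continuousMap_abs_sub_le {X Y : Type*} [Nonempty X] [PseudoMetricSpace Y]
    {f : X → ℝ} {D : X → Y} {C ε δ : ℝ} (hf : ∀ x, |f x| ≤ C) (hδ : 0 < δ) (hε : 0 ≤ ε)
    (h : ∀ x y, dist (D x) (D y) < δ → |f x - f y| ≤ ε) :
    ∃ F : C(Y, ℝ), ∀ x, |f x - F (D x)| ≤ ε := by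
  have hC : 0 ≤ C := (abs_nonneg _).trans (hf (Classical.arbitrary X))
  set c := 2 * C / δ
  have hc : 0 ≤ c := by positivity
  set F : Y → ℝ := fun y => ⨆ x, (f x - c * dist y (D x)) with hF
  have hbdd : ∀ y, BddAbove (Set.range fun x => f x - c * dist y (D x)) := by
    rintro y
    refine ⟨C, ?_⟩
    rintro _ ⟨x, rfl⟩
    have := mul_nonneg hc (dist_nonneg (x := y) (y := D x))
    linarith [(abs_le.1 (hf x)).2]
  have hlip : LipschitzWith c.toNNReal F := by
    refine LipschitzWith.of_le_add_mul _ fun y z => ?_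
    rw [Real.coe_toNNReal _ hc]
    refine ciSup_le fun x => ?_
    have h1 : f x - c * dist z (D x) ≤ F z := le_ciSup (hbdd z) x
    have h2 := mul_le_mul_of_nonneg_left (dist_triangle z y (D x)) hc
    rw [dist_comm z y] at h2
    linarith
  refine ⟨⟨F, hlip.continuous⟩, fun x => abs_le.2 ⟨?_, ?_⟩⟩
  · have : F (D x) ≤ f x + ε := by
      refine ciSup_le fun y => ?_
      rcases lt_or_ge (dist (D x) (D y)) δ with hlt | hge
      · have := mul_nonneg hc (dist_nonneg (x := D x) (y := D y))
        linarith [(abs_le.1 (h x y hlt)).1]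
      · have h1 : c * δ ≤ c * dist (D x) (D y) := mul_le_mul_of_nonneg_left hge hc
        have h2 : c * δ = 2 * C := div_mul_cancel₀ _ hδ.ne'
        linarith [(abs_le.1 (hf x)).1, (abs_le.1 (hf y)).2]
    simp only [ContinuousMap.coe_mk]
    linarith
  · have : f x - c * dist (D x) (D x) ≤ F (D x) := le_ciSup (hbdd (D x)) x
    rw [dist_self, mul_zero, sub_zero] at this
    simp only [ContinuousMap.coe_mk]
    linarith

/-! ### Inner products and automorphisms of unit balls -/

namespace UnitaryRep

open ContLogic

variable {G : Type v}

/-- The interpretation of a function symbol in a structure for the language of Hilbert spaces with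
a unitary representation. -/
def op (M : Structure.{v, w} (repSignature G)) {k : ℕ} (f : RepFunc G k)
    (x : Fin k → M.Carrier) : M.Carrier :=
  M.func (k := k) f x

/-- The term obtained by applying a function symbol to terms. -/
def appTerm {n k : ℕ} (f : RepFunc G k) (ts : Fin k → Term (repSignature G) n) :
    Term (repSignature G) n :=
  .app (k := k) f ts

theorem eval_appTerm (M : Structure.{v, w} (repSignature G)) {n k : ℕ} (f : RepFunc G k)
    (ts : Fin k → Term (repSignature G) n) (a : Fin n → M.Carrier) :
    (appTerm f ts).eval M a = op M f fun i => (ts i).eval M a := rfl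

/-- The real part of the inner product, written with the metric by means of the identity
`re ⟪x, y⟫ = 2 ‖(x + y) / 2‖² - ‖x‖² / 2 - ‖y‖² / 2`. -/
noncomputable def reKernel (M : Structure.{v, w} (repSignature G)) (x y : M.Carrier) : ℝ :=
  2 * dist (op M RepFunc.mid ![x, y]) (op M RepFunc.zero ![]) ^ 2
    - dist x (op M RepFunc.zero ![]) ^ 2 / 2 - dist y (op M RepFunc.zero ![]) ^ 2 / 2

/-- The inner product of a structure, written with the metric. The symbol `e^{2πi/4}` is
multiplication by `i`, and `im ⟪x, y⟫ = re ⟪i x, y⟫`. -/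
noncomputable def kernel (M : Structure.{v, w} (repSignature G)) (x y : M.Carrier) : ℂ :=
  ⟨reKernel M x y, reKernel M (op M (RepFunc.rot (1 / 4)) ![x]) y⟩

/-- The quantifier-free formula for `reKernel`. -/
noncomputable def reKernelFormula {n : ℕ} (s t : Term (repSignature G) n) :
    Formula (repSignature G) n :=
  .connFamily (ι := Fin 3)
    ⟨fun x => 2 * x 0 ^ 2 - x 1 ^ 2 / 2 - x 2 ^ 2 / 2, by fun_prop⟩
    ![.dist (appTerm RepFunc.mid ![s, t])
        (appTerm RepFunc.zero ![]),
      .dist s (appTerm RepFunc.zero ![]),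
      .dist t (appTerm RepFunc.zero ![])]

theorem isQF_reKernelFormula {n : ℕ} (s t : Term (repSignature G) n) :
    (reKernelFormula s t).IsQF := by
  refine Formula.isQF_connFamily _ fun i => ?_
  fin_cases i <;> trivial

variable (M : Structure.{v, w} (repSignature G))

theorem eval_reKernelFormula {n : ℕ} (s t : Term (repSignature G) n) (a : Fin n → M.Carrier) :
    (reKernelFormula s t).eval M a = reKernel M (s.eval M a) (t.eval M a) := by
  have h0 : (fun i : Fin 0 => (![] i : Term (repSignature G) n).eval M a) = ![] :=
    Subsingleton.elim _ _
  have h2 : (fun i : Fin 2 => (![s, t] i).eval M a) = ![s.eval M a, t.eval M a] := by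
    funext i; fin_cases i <;> rfl
  simp [reKernelFormula, reKernel, Formula.eval, eval_appTerm, h0, h2]

/-- The quantifier-free formula for the real part or the imaginary part of `kernel`. -/
noncomputable def kernelFormula {n : ℕ} (s t : Term (repSignature G) n) (b : Bool) :
    Formula (repSignature G) n :=
  if b then reKernelFormula s t
  else reKernelFormula (appTerm (RepFunc.rot (1 / 4)) ![s]) t

theorem isQF_kernelFormula {n : ℕ} (s t : Term (repSignature G) n) (b : Bool) :
    (kernelFormula s t b).IsQF := by
  cases b <;> exact isQF_reKernelFormula _ _

theorem eval_kernelFormula {n : ℕ} (s t : Term (repSignature G) n) (a : Fin n → M.Carrier)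
    (b : Bool) : (kernelFormula s t b).eval M a
      = if b then (kernel M (s.eval M a) (t.eval M a)).re
        else (kernel M (s.eval M a) (t.eval M a)).im := by
  have h1 : (appTerm (RepFunc.rot (1 / 4)) ![s]).eval M a
      = op M (RepFunc.rot (1 / 4)) ![s.eval M a] := by
    rw [eval_appTerm]
    congr 1
    funext i; fin_cases i; rfl
  cases b
  · simp only [kernelFormula, eval_reKernelFormula, h1, kernel, Bool.false_eq_true, if_false]
  · simp only [kernelFormula, eval_reKernelFormula, kernel, if_true]

/-- A realization of `M` as the unit ball of a Hilbert space with a unitary representation: an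
isometry onto the closed unit ball that turns the symbols into their standard interpretations. -/
structure BallRealization [Group G] (M : Structure.{v, w} (repSignature G)) {H : Type u}
    [NormedAddCommGroup H] [InnerProductSpace ℂ H] [CompleteSpace H]
    (ρ : G →* unitary (H →L[ℂ] H)) where
  toFun : M.Carrier → H
  isometry : Isometry toFun
  range_eq : Set.range toFun = Metric.closedBall 0 1
  map_op : ∀ {k : ℕ} (f : RepFunc G k) (x : Fin k → M.Carrier),
    toFun (op M f x) = interp ρ f fun i => toFun (x i)

section Intertwiner

variable [Group G] {H : Type u} [NormedAddCommGroup H] [InnerProductSpace ℂ H] [CompleteSpace H]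
  {ρ : G →* unitary (H →L[ℂ] H)}

theorem interp_map {σ : H →L[ℂ] H} (hσ : σ ∈ unitary (H →L[ℂ] H))
    (hc : ∀ g, Commute (ρ g : H →L[ℂ] H) σ) {k : ℕ} (f : RepFunc G k) (x : Fin k → H) :
    interp ρ f (fun i => σ (x i)) = σ (interp ρ f x) := by
  cases f with
  | zero => simp [interp]
  | neg => simp [interp]
  | double =>
    simp only [interp, trunc, ← σ.map_smul_of_tower,
      ContinuousLinearMap.norm_map_of_mem_unitary hσ]
  | mid => simp only [interp, ← σ.map_smul_of_tower, ← map_add]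
  | rot q => simp [interp]
  | act g =>
    simp only [interp]
    rw [← mul_apply_eq_comp, (hc g).eq, mul_apply_eq_comp]

variable {M}

theorem BallRealization.norm_le (ι : BallRealization M ρ) (x : M.Carrier) : ‖ι.toFun x‖ ≤ 1 := by
  have : ι.toFun x ∈ Metric.closedBall (0 : H) 1 := ι.range_eq ▸ ⟨x, rfl⟩
  simpa using this

theorem BallRealization.dist_eq (ι : BallRealization M ρ) (x y : M.Carrier) :
    dist x y = ‖ι.toFun x - ι.toFun y‖ := by
  rw [← ι.isometry.dist_eq, dist_eq_norm]

theorem BallRealization.reKernel_eq (ι : BallRealization M ρ) (x y : M.Carrier) :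
    reKernel M x y = (⟪ι.toFun x, ι.toFun y⟫_ℂ).re := by
  have h := norm_add_sq (𝕜 := ℂ) (ι.toFun x) (ι.toFun y)
  have h0 : ι.toFun (op M RepFunc.zero ![]) = 0 := ι.map_op RepFunc.zero _
  have hm : ι.toFun (op M RepFunc.mid ![x, y]) = (2⁻¹ : ℝ) • (ι.toFun x + ι.toFun y) :=
    ι.map_op RepFunc.mid _
  simp only [reKernel, ι.dist_eq, h0, hm, sub_zero, norm_smul, mul_pow, h, RCLike.re_to_complex]
  norm_num
  ring

theorem exp_quarter_turn :
    Complex.exp (2 * Real.pi * ((1 / 4 : ℚ) : ℂ) * Complex.I) = Complex.I := by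
  have : (2 * Real.pi * ((1 / 4 : ℚ) : ℂ) * Complex.I) = Real.pi / 2 * Complex.I := by
    push_cast; ring
  rw [this, Complex.exp_pi_div_two_mul_I]

theorem BallRealization.kernel_eq (ι : BallRealization M ρ) (x y : M.Carrier) :
    kernel M x y = ⟪ι.toFun x, ι.toFun y⟫_ℂ := by
  have hr : ι.toFun (op M (RepFunc.rot (1 / 4)) ![x]) = Complex.I • ι.toFun x := by
    rw [← exp_quarter_turn]
    exact ι.map_op (RepFunc.rot (1 / 4)) _
  refine Complex.ext (ι.reKernel_eq x y) ?_
  change reKernel M (op M (RepFunc.rot (1 / 4)) ![x]) y = _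
  rw [ι.reKernel_eq, hr, inner_smul_left]
  simp

/-- Unitary operators that commute with the representation induce automorphisms of the unit
ball. -/
theorem BallRealization.exists_automorphism (ι : BallRealization M ρ) {σ : H →L[ℂ] H}
    (hσ : σ ∈ unitary (H →L[ℂ] H)) (hc : ∀ g, Commute (ρ g : H →L[ℂ] H) σ) :
    ∃ τ : Automorphism M, ∀ x, ι.toFun (τ.toIsometryEquiv x) = σ (ι.toFun x) := by
  have lift : ∀ {s : H →L[ℂ] H}, s ∈ unitary (H →L[ℂ] H) → ∀ x, ∃ y, ι.toFun y = s (ι.toFun x) := by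
    intro s hs x
    have : s (ι.toFun x) ∈ Metric.closedBall (0 : H) 1 := by
      simpa [ContinuousLinearMap.norm_map_of_mem_unitary hs] using ι.norm_le x
    rwa [← ι.range_eq] at this
  choose t ht using lift hσ
  choose t' ht' using lift (Unitary.star_mem hσ)
  have inj := ι.isometry.injective
  let e : M.Carrier ≃ᵢ M.Carrier :=
    { toFun := t
      invFun := t'
      left_inv := fun x => inj (by
        rw [ht', ht, ← mul_apply_eq_comp, Unitary.star_mul_self_of_mem hσ, one_apply_eq_self])
      right_inv := fun x => inj (by
        rw [ht, ht', ← mul_apply_eq_comp, Unitary.mul_star_self_of_mem hσ, one_apply_eq_self])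
      isometry_toFun := Isometry.of_dist_eq fun x y => by
        rw [← ι.isometry.dist_eq, ht, ht, dist_eq_norm, ← map_sub,
          ContinuousLinearMap.norm_map_of_mem_unitary hσ, ← dist_eq_norm, ι.isometry.dist_eq] }
  have he : ∀ x, ι.toFun (e x) = σ (ι.toFun x) := ht
  have hop : ∀ {k : ℕ} (f : RepFunc G k) (x : Fin k → M.Carrier),
      e (op M f x) = op M f fun i => e (x i) := fun f x => inj (by
    rw [he, ι.map_op, ι.map_op, ← interp_map hσ hc]
    simp only [he])
  exact ⟨⟨e, fun f x => hop f x, fun P => P.elim⟩, ht⟩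

/-- The unit ball of a Hilbert space is realized by the inclusion. -/
noncomputable def BallRealization.ofBall (ρ : G →* unitary (H →L[ℂ] H)) :
    BallRealization (ballStructure ρ) ρ where
  toFun := fun x => x.1
  isometry := isometry_subtype_coe
  range_eq := Subtype.range_coe
  map_op := fun _ _ => rfl

end Intertwiner

end UnitaryRep

/-! ### Quantifier elimination and conjugacy of tuples -/

namespace UnitaryRep

open ContLogic

variable {G : Type v}

/-- The quantifier-free formulas for the real and imaginary parts of `⟪xᵢ, π(g) xⱼ⟫`. -/
noncomputable def orbitFormula {n : ℕ} (k : Fin n × Fin n × G × Bool) :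
    Formula (repSignature G) n :=
  kernelFormula (.var k.1) (appTerm (.act k.2.2.1) ![.var k.2.1]) k.2.2.2

theorem isQF_orbitFormula {n : ℕ} (k : Fin n × Fin n × G × Bool) : (orbitFormula k).IsQF :=
  isQF_kernelFormula _ _ _

variable [Group G] {H : Type u} [NormedAddCommGroup H] [InnerProductSpace ℂ H] [CompleteSpace H]
  {ρ : G →* unitary (H →L[ℂ] H)} {M : Structure.{v, w} (repSignature G)}

theorem BallRealization.eval_orbitFormula (ι : BallRealization M ρ) {n : ℕ}
    (k : Fin n × Fin n × G × Bool) (a : Fin n → M.Carrier) :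
    (orbitFormula k).eval M a =
      if k.2.2.2 then (⟪ι.toFun (a k.1), (ρ k.2.2.1 : H →L[ℂ] H) (ι.toFun (a k.2.1))⟫_ℂ).re
      else (⟪ι.toFun (a k.1), (ρ k.2.2.1 : H →L[ℂ] H) (ι.toFun (a k.2.1))⟫_ℂ).im := by
  rw [orbitFormula, eval_kernelFormula, eval_appTerm, ι.kernel_eq, ι.map_op]
  rfl

/-- Tuples with the same quantifier-free type are conjugate by an automorphism. -/
theorem BallRealization.exists_automorphism_map_eq [Finite G] (ι : BallRealization M ρ) {n : ℕ}
    {a b : Fin n → M.Carrier} (h : M.qfType a = M.qfType b) :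
    ∃ τ : Automorphism M, ∀ i, τ.toIsometryEquiv (a i) = b i := by
  obtain ⟨σ, hσ, hc, hm⟩ := exists_intertwiner_map_eq ρ
    (a := fun i => ι.toFun (a i)) (b := fun i => ι.toFun (b i)) (fun i j g => by
      have key := fun c : Bool =>
        Structure.eval_eq_of_qfType_eq h (isQF_orbitFormula (i, j, g, c))
      simp only [ι.eval_orbitFormula] at key
      exact Complex.ext (key true) (key false))
  obtain ⟨τ, hτ⟩ := ι.exists_automorphism hσ hc
  exact ⟨τ, fun i => ι.isometry.injective (by rw [hτ, hm])⟩

theorem hasQuantifierElimination_IHS [Finite G] (ρ : G →* unitary (H →L[ℂ] H)) :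
    Theory.HasQuantifierElimination.{v, w} (IHS ρ) := by
  refine Structure.theory_hasQuantifierElimination _ fun n φ ε hε => ?_
  have := Fintype.ofFinite G
  set N := ballStructure ρ
  let ι : BallRealization N ρ := .ofBall ρ
  obtain ⟨C, hC⟩ := φ.exists_abs_eval_le N
  obtain ⟨δ₁, hδ₁, h₁⟩ := Metric.uniformContinuous_iff.1 (φ.uniformContinuous_eval N) ε hε
  obtain ⟨δ, hδ, h⟩ := exists_intertwiner_norm_sub_le ρ n (half_pos hδ₁)
  let D : (Fin n → N.Carrier) → (Fin n × Fin n × G × Bool) → ℝ :=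
    fun a k => (orbitFormula k).eval N a
  have hD : ∀ a b, dist (D a) (D b) < δ / 2 → |φ.eval N a - φ.eval N b| ≤ ε := by
    intro a b hab
    obtain ⟨σ, hσ, hc, hm⟩ := h (fun i => ι.toFun (a i)) (fun i => ι.toFun (b i))
      (fun i => ι.norm_le _) (fun i => ι.norm_le _) (fun i j g => by
        have key := fun c : Bool => (dist_le_pi_dist (D a) (D b) (i, j, g, c)).trans hab.le
        simp only [D, ι.eval_orbitFormula, Real.dist_eq] at key
        refine (Complex.norm_le_abs_re_add_abs_im _).trans ?_
        rw [Complex.sub_re, Complex.sub_im]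
        have h1 := key true
        have h2 := key false
        simp only [if_true, Bool.false_eq_true, if_false] at h1 h2
        linarith)
    -- Move `a` close to `b` by an automorphism, which does not change the value of `φ`.
    obtain ⟨τ, hτ⟩ := ι.exists_automorphism hσ hc
    rw [← τ.eval_formula φ a]
    refine (h₁ ((dist_pi_lt_iff hδ₁).2 fun i => ?_)).le
    rw [ι.dist_eq, hτ]
    exact (hm i).trans_lt (half_lt_self hδ₁)
  obtain ⟨F, hF⟩ := exists_continuousMap_abs_sub_le (D := D) hC (half_pos hδ) hε.le hD
  refine ⟨.connFamily F orbitFormula, Formula.isQF_connFamily _ isQF_orbitFormula, fun a => ?_⟩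
  rw [Formula.eval_connFamily]
  exact hF a

end UnitaryRep

/-! ### Unit balls and Hilbert spaces from kernels -/

/-- A closed subset of the unit ball of a Hilbert space with dense span is the whole ball if it is
closed under midpoints, multiplication by `i`, and doubling of vectors of norm at most `1 / 2`. -/
theorem eq_closedBall_of_closed_under_midpoint {H : Type*} [NormedAddCommGroup H]
    [InnerProductSpace ℂ H] {C : Set H} (hC : IsClosed C) (h1 : C ⊆ Metric.closedBall 0 1)
    (h0 : (0 : H) ∈ C) (hmid : ∀ x ∈ C, ∀ y ∈ C, (2⁻¹ : ℝ) • (x + y) ∈ C)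
    (hI : ∀ x ∈ C, Complex.I • x ∈ C) (hdouble : ∀ x ∈ C, ‖x‖ ≤ 1 / 2 → (2 : ℝ) • x ∈ C)
    (hspan : (Submodule.span ℂ C).topologicalClosure = ⊤) : C = Metric.closedBall 0 1 := by
  have hhalf : ∀ x ∈ C, (2⁻¹ : ℝ) • x ∈ C := fun x hx => by simpa using hmid x hx 0 h0
  have hpow : ∀ (k : ℕ), ∀ x ∈ C, ((2⁻¹ : ℝ) ^ k) • x ∈ C := by
    intro k
    induction k with
    | zero => simp
    | succ k ih => intro x hx; rw [pow_succ', mul_smul]; exact hhalf _ (ih x hx)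
  -- The vectors that dyadic scaling brings into `C`.
  let D : AddSubgroup H :=
    { carrier := {x | ∃ N : ℕ, ((2⁻¹ : ℝ) ^ N) • x ∈ C}
      zero_mem' := ⟨0, by simpa using h0⟩
      add_mem' := by
        rintro x y ⟨N, hN⟩ ⟨N', hN'⟩
        refine ⟨N + N' + 1, ?_⟩
        have e : ((2⁻¹ : ℝ) ^ (N + N' + 1)) • (x + y)
            = (2⁻¹ : ℝ) • (((2⁻¹ : ℝ) ^ N') • ((2⁻¹ : ℝ) ^ N) • x
              + ((2⁻¹ : ℝ) ^ N) • ((2⁻¹ : ℝ) ^ N') • y) := by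
          module
        rw [e]
        exact hmid _ (hpow _ _ hN) _ (hpow _ _ hN')
      neg_mem' := by
        rintro x ⟨N, hN⟩
        refine ⟨N, ?_⟩
        have := hI _ (hI _ hN)
        rwa [← mul_smul, Complex.I_mul_I, neg_one_smul, ← smul_neg] at this }
  have hDI : ∀ x ∈ D, Complex.I • x ∈ D := by
    rintro x ⟨N, hN⟩
    refine ⟨N, ?_⟩
    rw [smul_comm]
    exact hI _ hN
  have hDpow : ∀ (k : ℕ), ∀ x ∈ D, ((2⁻¹ : ℝ) ^ k) • x ∈ D := by
    rintro k x ⟨N, hN⟩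
    refine ⟨N, ?_⟩
    rw [smul_comm]
    exact hpow _ _ hN
  let S := D.topologicalClosure
  have hSmap : ∀ f : H → H, Continuous f → (∀ x ∈ D, f x ∈ D) → ∀ x ∈ S, f x ∈ S :=
    fun f hf h x hx => map_mem_closure hf hx h
  have hSclosed : IsClosed (S : Set H) := D.isClosed_topologicalClosure
  have hSnonneg : ∀ (r : ℝ), 0 ≤ r → ∀ x ∈ S, r • x ∈ S := by
    intro r hr x hx
    have hlim : Filter.Tendsto (fun k : ℕ => (⌊r * 2 ^ k⌋₊ : ℝ) / 2 ^ k) Filter.atTop (nhds r) :=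
      (tendsto_nat_floor_mul_div_atTop hr).comp
        (tendsto_pow_atTop_atTop_of_one_lt (one_lt_two : (1 : ℝ) < 2))
    refine hSclosed.mem_of_tendsto (hlim.smul_const x) (Filter.Eventually.of_forall fun k => ?_)
    have e : ((⌊r * 2 ^ k⌋₊ : ℝ) / 2 ^ k) • x = ⌊r * 2 ^ k⌋₊ • (((2⁻¹ : ℝ) ^ k) • x) := by
      rw [← Nat.cast_smul_eq_nsmul ℝ, ← mul_smul, div_eq_mul_inv, inv_pow]
    rw [e]
    exact S.nsmul_mem (hSmap _ (continuous_const_smul _) (hDpow k) x hx) _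
  have hSreal : ∀ (r : ℝ), ∀ x ∈ S, r • x ∈ S := by
    intro r x hx
    rcases le_total 0 r with hr | hr
    · exact hSnonneg r hr x hx
    · have := S.neg_mem (hSnonneg (-r) (neg_nonneg.2 hr) x hx)
      rwa [neg_smul, neg_neg] at this
  let V : Submodule ℂ H :=
    { S.toAddSubmonoid with
      smul_mem' := fun z x hx => by
        have e : z • x = z.re • x + z.im • (Complex.I • x) := by
          rw [← Complex.coe_smul, ← Complex.coe_smul, ← mul_smul, ← add_smul, Complex.re_add_im]
        rw [e]
        exact S.add_mem (hSreal _ _ hx)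
          (hSreal _ _ (hSmap _ (continuous_const_smul _) hDI x hx)) }
  have hVtop : (⊤ : Submodule ℂ H) ≤ V := by
    rw [← hspan]
    refine Submodule.topologicalClosure_minimal _ (Submodule.span_le.2 fun x hx => ?_) hSclosed
    exact D.le_topologicalClosure ⟨0, by simpa using hx⟩
  have hdense : Dense (D : Set H) := fun x => hVtop (Submodule.mem_top (x := x))
  have hDC : ∀ (N : ℕ) (x : H), ‖x‖ ≤ 1 → ((2⁻¹ : ℝ) ^ N) • x ∈ C → x ∈ C := by
    intro N
    induction N with
    | zero => intro x _ h; simpa using h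
    | succ N ih =>
      intro x hx h
      have hn : ‖(2⁻¹ : ℝ) • x‖ ≤ 1 / 2 := by
        rw [norm_smul, Real.norm_of_nonneg (by norm_num)]
        linarith
      have h2 := hdouble _ (ih ((2⁻¹ : ℝ) • x) (by linarith) (by rwa [← mul_smul, ← pow_succ])) hn
      rwa [smul_smul, mul_inv_cancel₀ two_ne_zero, one_smul] at h2
  refine h1.antisymm ?_
  rw [← closure_ball (0 : H) one_ne_zero]
  refine closure_minimal ?_ hC
  refine (hdense.open_subset_closure_inter Metric.isOpen_ball).trans (closure_minimal ?_ hC)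
  rintro x ⟨hx, N, hN⟩
  exact hDC N x (by simpa using (Metric.ball_subset_closedBall hx)) hN

/-- Every positive semidefinite kernel is the Gram matrix of a family of vectors with dense span
in a Hilbert space. -/
theorem exists_hilbertSpace_of_kernel {X : Type w} (k : X → X → ℂ)
    (hherm : ∀ x y, conj (k x y) = k y x)
    (hpos : ∀ (m : ℕ) (c : Fin m → ℂ) (x : Fin m → X),
      0 ≤ (∑ i, ∑ j, conj (c i) * c j * k (x i) (x j)).re) :
    ∃ (H : Type w) (_ : NormedAddCommGroup H) (_ : InnerProductSpace ℂ H) (_ : CompleteSpace H)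
      (ι : X → H), (∀ x y, ⟪ι x, ι y⟫_ℂ = k x y) ∧
        (Submodule.span ℂ (Set.range ι)).topologicalClosure = ⊤ := by
  let A : Matrix X X (ℂ →L[ℂ] ℂ) := .of fun x y => k x y • ContinuousLinearMap.id ℂ ℂ
  have hA : A.IsHermitian := by
    ext x y
    simp [A, Matrix.conjTranspose_apply, ContinuousLinearMap.star_eq_adjoint, hherm,
      ContinuousLinearMap.adjoint_id]
  have hps : A.PosSemidef := by
    refine ((RKHS.posSemidef_tfae (K := A)).out 0 2).2 (And.intro hA fun c => ?_)
    let e := c.support.equivFin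
    have h := hpos _ (fun i => c (e.symm i)) fun i => (e.symm i : X)
    refine h.trans_eq ?_
    rw [RCLike.re_to_complex]
    congr 1
    simp only [Finsupp.sum]
    have hsum : ∀ f : X → ℂ, ∑ x ∈ c.support, f x = ∑ i, f (e.symm i) := fun f => by
      rw [← Finset.sum_coe_sort c.support f, ← Equiv.sum_comp e.symm]
    simp only [hsum]
    refine Finset.sum_congr rfl fun i _ => Finset.sum_congr rfl fun j _ => ?_
    simp [A, hherm]
    ring
  have : Fact A.PosSemidef := ⟨hps⟩
  refine ⟨RKHS.OfKernel A, inferInstance, inferInstance, inferInstance,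
    fun x => RKHS.kerFun (RKHS.OfKernel A) x 1, fun x y => ?_, ?_⟩
  · rw [← RKHS.kernel_inner, RKHS.OfKernel.kernel_ofKernel]
    simp [A, hherm]
  · have hd := RKHS.kerFun_dense (RKHS.OfKernel A)
    rw [eq_top_iff, ← hd]
    refine Submodule.topologicalClosure_mono (Submodule.span_le.2 ?_)
    rintro _ ⟨x, v, rfl⟩
    have : RKHS.kerFun (RKHS.OfKernel A) x v = v • RKHS.kerFun (RKHS.OfKernel A) x 1 := by
      rw [← map_smul, smul_eq_mul, mul_one]
    rw [this]
    exact Submodule.smul_mem _ _ (Submodule.subset_span ⟨x, rfl⟩)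

/-! ### Transfer of identities between inner products -/

namespace UnitaryRep

open ContLogic

variable {G : Type v}

/-- The formula for a continuous function of the inner products and the distances of finitely many
terms. -/
noncomputable def gramFormula {n : ℕ} {J : Type*} [Fintype J] (t : J → Term (repSignature G) n)
    (F : (J → J → ℂ) → (J → J → ℝ) → ℝ) (hF : Continuous (Function.uncurry F)) :
    Formula (repSignature G) n :=
  .connFamily (ι := J × J × Option Bool)
    ⟨fun x => Function.uncurry F
      (fun i j => (x (i, j, some true) : ℂ) + x (i, j, some false) * Complex.I,
        fun i j => x (i, j, none)), hF.comp (by fun_prop)⟩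
    fun k => match k with
      | (i, j, some b) => kernelFormula (t i) (t j) b
      | (i, j, none) => .dist (t i) (t j)

theorem eval_gramFormula {n : ℕ} {J : Type*} [Fintype J] (t : J → Term (repSignature G) n)
    (F : (J → J → ℂ) → (J → J → ℝ) → ℝ) (hF : Continuous (Function.uncurry F))
    (N : Structure.{v, w} (repSignature G)) (a : Fin n → N.Carrier) :
    (gramFormula t F hF).eval N a
      = F (fun i j => kernel N ((t i).eval N a) ((t j).eval N a))
        (fun i j => dist ((t i).eval N a) ((t j).eval N a)) := by
  simp only [gramFormula, Formula.eval_connFamily, ContinuousMap.coe_mk, Function.uncurry,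
    eval_kernelFormula, if_true, Bool.false_eq_true, if_false, Complex.re_add_im]
  rfl

variable [Group G] {K : Type u} [NormedAddCommGroup K] [InnerProductSpace ℂ K]
  [CompleteSpace K] {π : G →* unitary (K →L[ℂ] K)} {M : Structure.{v, w} (repSignature G)}

/-- Universal conditions on the inner products and the distances of finitely many terms pass from
`(K, π)` to the models of its theory. -/
theorem gram_le_zero (hM : (IHS π).Model M) {n : ℕ} {J : Type*} [Fintype J]
    (t : J → Term (repSignature G) n) (F : (J → J → ℂ) → (J → J → ℝ) → ℝ)
    (hF : Continuous (Function.uncurry F))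
    (h : ∀ a : Fin n → (ballStructure π).Carrier,
      F (fun i j => ⟪(BallRealization.ofBall π).toFun ((t i).eval _ a),
          (BallRealization.ofBall π).toFun ((t j).eval _ a)⟫_ℂ)
        (fun i j => ‖(BallRealization.ofBall π).toFun ((t i).eval _ a)
          - (BallRealization.ofBall π).toFun ((t j).eval _ a)‖) ≤ 0)
    (a : Fin n → M.Carrier) :
    F (fun i j => kernel M ((t i).eval M a) ((t j).eval M a))
      (fun i j => dist ((t i).eval M a) ((t j).eval M a)) ≤ 0 := by
  rw [← eval_gramFormula t F hF]
  refine hM.eval_le_zero _ (fun b => ?_) a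
  rw [eval_gramFormula]
  simp only [(BallRealization.ofBall π).kernel_eq, (BallRealization.ofBall π).dist_eq]
  exact h b

theorem sum_sum_inner {J E : Type*} [Fintype J] [NormedAddCommGroup E] [InnerProductSpace ℂ E]
    (c : J → ℂ) (x : J → E) :
    ∑ i, ∑ j, conj (c i) * c j * ⟪x i, x j⟫_ℂ = ⟪∑ i, c i • x i, ∑ j, c j • x j⟫_ℂ := by
  rw [sum_inner]
  refine Finset.sum_congr rfl fun i _ => ?_
  rw [inner_sum]
  refine Finset.sum_congr rfl fun j _ => ?_
  rw [inner_smul_left, inner_smul_right, mul_assoc]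

theorem norm_two_smul_eq {E : Type*} [NormedAddCommGroup E] [InnerProductSpace ℂ E] (y : E) :
    ‖(2 : ℝ) • y‖ = 2 * √(⟪y, y⟫_ℂ).re := by
  rw [norm_smul, Real.norm_of_nonneg zero_le_two, @norm_eq_sqrt_re_inner ℂ]
  rfl

theorem term_eq_of_model (hM : (IHS π).Model M) {n : ℕ} (s t : Term (repSignature G) n)
    (h : ∀ a : Fin n → (ballStructure π).Carrier,
      (BallRealization.ofBall π).toFun (s.eval _ a)
        = (BallRealization.ofBall π).toFun (t.eval _ a)) (a : Fin n → M.Carrier) :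
    s.eval M a = t.eval M a := by
  have := hM.eval_le_zero (.dist s t) (fun b => by
    rw [Formula.eval, (BallRealization.ofBall π).isometry.injective (h b), dist_self]) a
  exact dist_le_zero.1 this

theorem conj_kernel_of_model (hM : (IHS π).Model M) (x y : M.Carrier) :
    conj (kernel M x y) = kernel M y x := by
  have := gram_le_zero hM (J := Fin 2) (n := 2) (fun i => .var i)
    (fun k _ => ‖conj (k 0 1) - k 1 0‖)
    (by simp only [Function.uncurry_def]; fun_prop) (fun a => by simp) ![x, y]
  simpa [Term.eval, sub_eq_zero] using this

theorem kernel_self_re_le_one_of_model (hM : (IHS π).Model M) (x : M.Carrier) :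
    (kernel M x x).re ≤ 1 := by
  have := gram_le_zero hM (J := Fin 1) (n := 1) (fun i => .var i)
    (fun k _ => (k 0 0).re - 1)
    (by simp only [Function.uncurry_def]; fun_prop) (fun a => by
      have h := (BallRealization.ofBall π).norm_le (a 0)
      have h2 : (⟪(BallRealization.ofBall π).toFun (a 0),
        (BallRealization.ofBall π).toFun (a 0)⟫_ℂ).re = _ := inner_self_eq_norm_sq (𝕜 := ℂ) _
      simp only [Term.eval, h2]
      nlinarith [norm_nonneg ((BallRealization.ofBall π).toFun (a 0))]) ![x]
  simpa [Term.eval] using this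

theorem dist_sq_of_model (hM : (IHS π).Model M) (x y : M.Carrier) :
    dist x y ^ 2 = (kernel M x x + kernel M y y - kernel M x y - kernel M y x).re := by
  have := gram_le_zero hM (J := Fin 2) (n := 2) (fun i => .var i)
    (fun k d => |d 0 1 ^ 2 - (k 0 0 + k 1 1 - k 0 1 - k 1 0).re|)
    (by simp only [Function.uncurry_def]; fun_prop) (fun a => by
      rw [← @inner_self_eq_norm_sq ℂ]
      simp only [inner_sub_left, inner_sub_right, RCLike.re_to_complex, Complex.sub_re,
        Complex.add_re]
      refine (abs_eq_zero.2 ?_).le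
      ring) ![x, y]
  have := abs_eq_zero.1 (this.antisymm (abs_nonneg _))
  simpa [Term.eval, sub_eq_zero] using this

theorem kernel_act_of_model (hM : (IHS π).Model M) (g : G) (x y : M.Carrier) :
    kernel M (op M (.act g) ![x]) (op M (.act g) ![y]) = kernel M x y := by
  have := gram_le_zero hM (J := Fin 4) (n := 2)
    ![.var 0, .var 1, appTerm (.act g) ![.var 0], appTerm (.act g) ![.var 1]]
    (fun k _ => ‖k 2 3 - k 0 1‖)
    (by simp only [Function.uncurry_def]; fun_prop) (fun a => by
      simp [eval_appTerm, Term.eval, BallRealization.map_op, interp,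
        ContinuousLinearMap.inner_map_map_of_mem_unitary (π g).2]) ![x, y]
  have h := norm_le_zero_iff.1 this
  rw [sub_eq_zero] at h
  simp only [Matrix.cons_val, eval_appTerm] at h
  convert h using 2 <;> congr 1 <;> funext i <;> fin_cases i <;> rfl

theorem sum_kernel_nonneg_of_model (hM : (IHS π).Model M) (m : ℕ) (c : Fin m → ℂ)
    (x : Fin m → M.Carrier) : 0 ≤ (∑ i, ∑ j, conj (c i) * c j * kernel M (x i) (x j)).re := by
  have := gram_le_zero hM (J := Fin m) (n := m) (fun i => .var i)
    (fun k _ => -(∑ i, ∑ j, conj (c i) * c j * k i j).re)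
    (by simp only [Function.uncurry_def]; fun_prop) (fun a => by
      rw [neg_nonpos]
      set e := fun i => (BallRealization.ofBall π).toFun (a i)
      change 0 ≤ (∑ i, ∑ j, conj (c i) * c j * ⟪e i, e j⟫_ℂ).re
      rw [sum_sum_inner]
      exact inner_self_nonneg (𝕜 := ℂ)) x
  exact neg_nonpos.1 this

section Realize

variable {H : Type w} [NormedAddCommGroup H] [InnerProductSpace ℂ H] {ι : M.Carrier → H}

/-- Linear relations between terms, with coefficients that may depend continuously on the inner
products of the terms, pass from `(K, π)` to every family of vectors that represents `kernel M`:
they say that a certain norm vanishes. -/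
theorem sum_smul_eq_zero_of_model (hM : (IHS π).Model M)
    (hι : ∀ x y, ⟪ι x, ι y⟫_ℂ = kernel M x y) {n : ℕ} {J : Type*} [Fintype J]
    (t : J → Term (repSignature G) n) (c : (J → J → ℂ) → J → ℂ) (hc : Continuous c)
    (h : ∀ a : Fin n → (ballStructure π).Carrier,
      ∑ j, c (fun i j => ⟪(BallRealization.ofBall π).toFun ((t i).eval _ a),
          (BallRealization.ofBall π).toFun ((t j).eval _ a)⟫_ℂ) j •
        (BallRealization.ofBall π).toFun ((t j).eval _ a) = 0)
    (a : Fin n → M.Carrier) :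
    ∑ j, c (fun i j => ⟪ι ((t i).eval M a), ι ((t j).eval M a)⟫_ℂ) j • ι ((t j).eval M a) = 0 := by
  have := gram_le_zero hM t (fun k _ => (∑ i, ∑ j, conj (c k i) * c k j * k i j).re)
    (by simp only [Function.uncurry_def]; fun_prop) (fun a => by
      simp only
      rw [sum_sum_inner, h a, inner_zero_left, Complex.zero_re]) a
  simp only [← hι] at this
  rw [sum_sum_inner] at this
  have h2 : ‖∑ j, c (fun i j => ⟪ι ((t i).eval M a), ι ((t j).eval M a)⟫_ℂ) j •
      ι ((t j).eval M a)‖ ^ 2 ≤ 0 := by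
    rw [← @inner_self_eq_norm_sq ℂ]
    exact this
  exact norm_eq_zero.1 (pow_eq_zero_iff two_ne_zero |>.1 (h2.antisymm (sq_nonneg _)))

theorem map_zero_of_model (hM : (IHS π).Model M) (hι : ∀ x y, ⟪ι x, ι y⟫_ℂ = kernel M x y)
    (x : Fin 0 → M.Carrier) : ι (op M .zero x) = 0 := by
  have := sum_smul_eq_zero_of_model hM hι (J := Fin 1) ![appTerm .zero .var] (fun _ => ![1])
    (by fun_prop) (fun a => by simp [eval_appTerm, BallRealization.map_op, interp]) x
  simpa [eval_appTerm, Term.eval] using this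

theorem map_neg_of_model (hM : (IHS π).Model M) (hι : ∀ x y, ⟪ι x, ι y⟫_ℂ = kernel M x y)
    (x : Fin 1 → M.Carrier) : ι (op M .neg x) = -ι (x 0) := by
  have := sum_smul_eq_zero_of_model hM hι (J := Fin 2) ![appTerm .neg .var, .var 0]
    (fun _ => ![1, 1]) (by fun_prop)
    (fun a => by simp [eval_appTerm, Term.eval, BallRealization.map_op, interp]) x
  simp [Fin.sum_univ_succ, eval_appTerm, Term.eval] at this
  exact eq_neg_of_add_eq_zero_left this

theorem map_rot_of_model (hM : (IHS π).Model M) (hι : ∀ x y, ⟪ι x, ι y⟫_ℂ = kernel M x y) (q : ℚ)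
    (x : Fin 1 → M.Carrier) :
    ι (op M (.rot q) x) = Complex.exp (2 * Real.pi * q * Complex.I) • ι (x 0) := by
  have := sum_smul_eq_zero_of_model hM hι (J := Fin 2) ![appTerm (.rot q) .var, .var 0]
    (fun _ => ![1, -Complex.exp (2 * Real.pi * q * Complex.I)]) (by fun_prop)
    (fun a => by simp [eval_appTerm, Term.eval, BallRealization.map_op, interp]) x
  simp [Fin.sum_univ_succ, eval_appTerm, Term.eval] at this
  exact eq_of_sub_eq_zero (by rw [sub_eq_add_neg]; exact this)

theorem map_mid_of_model (hM : (IHS π).Model M) (hι : ∀ x y, ⟪ι x, ι y⟫_ℂ = kernel M x y)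
    (x : Fin 2 → M.Carrier) : ι (op M .mid x) = (2⁻¹ : ℝ) • (ι (x 0) + ι (x 1)) := by
  have := sum_smul_eq_zero_of_model hM hι (J := Fin 3) ![appTerm .mid .var, .var 0, .var 1]
    (fun _ => ![1, ((-2⁻¹ : ℝ) : ℂ), ((-2⁻¹ : ℝ) : ℂ)]) (by fun_prop)
    (fun a => by
      simp only [Fin.sum_univ_three, Matrix.cons_val, eval_appTerm, Term.eval,
        BallRealization.map_op, interp, Complex.coe_smul, one_smul]
      module) x
  simp only [Fin.sum_univ_three, Matrix.cons_val, eval_appTerm, Term.eval, Complex.coe_smul,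
    one_smul] at this
  rw [← sub_eq_zero, ← this]
  module

theorem map_double_of_model (hM : (IHS π).Model M) (hι : ∀ x y, ⟪ι x, ι y⟫_ℂ = kernel M x y)
    (x : Fin 1 → M.Carrier) : ι (op M .double x) = trunc ((2 : ℝ) • ι (x 0)) := by
  -- The relation is `max 1 (2 ‖x‖) • 2̇ x = 2 • x`, with `‖x‖` written as `√⟪x, x⟫`.
  have := sum_smul_eq_zero_of_model hM hι (J := Fin 2) ![appTerm .double .var, .var 0]
    (fun k => ![((max 1 (2 * √(k 1 1).re) : ℝ) : ℂ), ((-2 : ℝ) : ℂ)]) (by fun_prop)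
    (fun a => by
      simp only [Fin.sum_univ_two, Matrix.cons_val, eval_appTerm, Term.eval,
        BallRealization.map_op, interp, Complex.coe_smul, ← norm_two_smul_eq, trunc]
      rw [smul_inv_smul₀ (lt_max_of_lt_left one_pos).ne']
      module) x
  simp only [Fin.sum_univ_two, Matrix.cons_val, eval_appTerm, Term.eval, Complex.coe_smul,
    ← norm_two_smul_eq] at this
  rw [trunc, eq_inv_smul_iff₀ (lt_max_of_lt_left one_pos).ne', ← sub_eq_zero, ← this]
  module

end Realize

end UnitaryRep

/-! ### Models are unit balls -/

namespace UnitaryRep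

open ContLogic

variable {G : Type v} [Group G] {K : Type u} [NormedAddCommGroup K] [InnerProductSpace ℂ K]
  [CompleteSpace K] {π : G →* unitary (K →L[ℂ] K)} {M : Structure.{v, w} (repSignature G)}

theorem op_act_mul_of_model (hM : (IHS π).Model M) (g h : G) (x : M.Carrier) :
    op M (.act (g * h)) ![x] = op M (.act g) ![op M (.act h) ![x]] := by
  have := term_eq_of_model hM (n := 1) (appTerm (.act (g * h)) .var)
    (appTerm (.act g) fun _ => appTerm (.act h) .var) (fun a => by
      simp [eval_appTerm, Term.eval, BallRealization.map_op, interp]) ![x]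
  simp only [eval_appTerm, Term.eval] at this
  convert this using 2
  all_goals
    funext i
    fin_cases i
    rfl

theorem op_act_one_of_model (hM : (IHS π).Model M) (x : M.Carrier) :
    op M (.act 1) ![x] = x := by
  have := term_eq_of_model hM (n := 1) (appTerm (.act 1) .var) (.var 0) (fun a => by
      simp [eval_appTerm, Term.eval, BallRealization.map_op, interp]) ![x]
  exact this

/-- Every model of `IHS π` is the unit ball of a Hilbert space with a unitary representation. -/
theorem exists_ballRealization (hM : (IHS π).Model M) :
    ∃ (H : Type w) (_ : NormedAddCommGroup H) (_ : InnerProductSpace ℂ H) (_ : CompleteSpace H)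
      (ρ : G →* unitary (H →L[ℂ] H)), Nonempty (BallRealization M ρ) := by
  obtain ⟨H, i1, i2, i3, ι, hι, hspan⟩ := exists_hilbertSpace_of_kernel (kernel M)
    (conj_kernel_of_model hM) (sum_kernel_nonneg_of_model hM)
  have hiso : Isometry ι := by
    refine Isometry.of_dist_eq fun x y => ?_
    rw [dist_eq_norm]
    refine (sq_eq_sq₀ (norm_nonneg _) dist_nonneg).1 ?_
    rw [dist_sq_of_model hM, ← @inner_self_eq_norm_sq ℂ]
    simp only [inner_sub_left, inner_sub_right, hι, RCLike.re_to_complex, Complex.sub_re,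
      Complex.add_re]
    ring
  have hact : ∀ g : G, ∃ L : H ≃ₗᵢ[ℂ] H, ∀ x, L (ι x) = ι (op M (.act g) ![x]) := by
    intro g
    refine InnerProductSpace.exists_linearIsometryEquiv_of_inner_eq (v := ι)
      (w := fun x => ι (op M (.act g) ![x])) hspan ?_ fun x y => ?_
    · have hsurj : Function.Surjective fun x : M.Carrier => op M (.act g) ![x] := fun x =>
        ⟨op M (.act g⁻¹) ![x], by
          simp only
          rw [← op_act_mul_of_model hM, mul_inv_cancel, op_act_one_of_model hM]⟩
      rw [← hspan, ← hsurj.range_comp ι]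
      rfl
    · rw [hι, hι, kernel_act_of_model hM]
  choose L hL using hact
  have hmul : ∀ g h, L (g * h) = L g * L h := by
    intro g h
    have hd : Dense (Submodule.span ℂ (Set.range ι) : Set H) :=
      (Submodule.dense_iff_topologicalClosure_eq_top).2 hspan
    have := ContinuousLinearMap.ext_on hd
      (f := ((L (g * h)).toContinuousLinearEquiv : H →L[ℂ] H))
      (g := ((L g * L h).toContinuousLinearEquiv : H →L[ℂ] H)) (by
        rintro _ ⟨x, rfl⟩
        change L (g * h) (ι x) = L g (L h (ι x))
        rw [hL, hL, hL, op_act_mul_of_model hM])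
    exact LinearIsometryEquiv.ext fun x => congrArg (fun f : H →L[ℂ] H => f x) this
  let ρ : G →* unitary (H →L[ℂ] H) :=
    Unitary.linearIsometryEquiv.symm.toMonoidHom.comp (MonoidHom.mk' L hmul)
  have hρ : ∀ g x, (ρ g : H →L[ℂ] H) x = L g x := fun g x => rfl
  have hop : ∀ {k : ℕ} (f : RepFunc G k) (x : Fin k → M.Carrier),
      ι (op M f x) = interp ρ f fun i => ι (x i) := by
    intro k f x
    cases f with
    | zero => exact map_zero_of_model hM hι x
    | neg => exact map_neg_of_model hM hι x
    | double => exact map_double_of_model hM hι x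
    | mid => exact map_mid_of_model hM hι x
    | rot q => exact map_rot_of_model hM hι q x
    | act g =>
      have : x = ![x 0] := by funext i; fin_cases i; rfl
      rw [interp, hρ, hL, ← this]
  refine ⟨H, i1, i2, i3, ρ, ⟨⟨ι, hiso, ?_, hop⟩⟩⟩
  refine eq_closedBall_of_closed_under_midpoint hiso.isClosedEmbedding.isClosed_range ?_ ?_ ?_ ?_
    ?_ hspan
  · rintro _ ⟨x, rfl⟩
    have h1 := kernel_self_re_le_one_of_model hM x
    rw [← hι] at h1
    have h2 : ‖ι x‖ ^ 2 ≤ 1 := by rw [← @inner_self_eq_norm_sq ℂ]; exact h1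
    simpa using h2
  · exact ⟨op M .zero ![], map_zero_of_model hM hι _⟩
  · rintro _ ⟨x, rfl⟩ _ ⟨y, rfl⟩
    exact ⟨op M .mid ![x, y], map_mid_of_model hM hι _⟩
  · rintro _ ⟨x, rfl⟩
    refine ⟨op M (.rot (1 / 4)) ![x], ?_⟩
    rw [map_rot_of_model hM hι, exp_quarter_turn]
    rfl
  · rintro _ ⟨x, rfl⟩ hx
    refine ⟨op M .double ![x], ?_⟩
    rw [map_double_of_model hM hι, trunc, max_eq_left, inv_one, one_smul]
    · rfl
    · simp only [Matrix.cons_val_zero]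
      rw [norm_smul, Real.norm_of_nonneg zero_le_two]
      linarith

end UnitaryRep

theorem mainTheorem4 {G : Type v} [Group G] [Finite G]
    {K : Type u} [NormedAddCommGroup K] [InnerProductSpace ℂ K] [CompleteSpace K]
    (hK : ¬ FiniteDimensional ℂ K) (π : G →* unitary (K →L[ℂ] K)) :
    ContLogic.Theory.HasQuantifierElimination.{v, w} (UnitaryRep.IHS π) ∧
    ∀ M : ContLogic.Structure.{v, w} (UnitaryRep.repSignature G),
      (UnitaryRep.IHS π).Model M → TopologicalSpace.SeparableSpace M.Carrier →
      ∀ (n : ℕ) (a b : Fin n → M.Carrier), M.qfType a = M.qfType b →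
        ∃ σ : ContLogic.Automorphism M, ∀ i, σ.toIsometryEquiv (a i) = b i := by
  refine ⟨UnitaryRep.hasQuantifierElimination_IHS π, fun M hM _ n a b hab => ?_⟩
  obtain ⟨H, _, _, _, ρ, ⟨ι⟩⟩ := UnitaryRep.exists_ballRealization hM
  exact ι.exists_automorphism_map_eq hab
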